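/- Let $M$ be a smooth ($C^\infty$) Riemannian manifold of dimension $n+1$ with metric $\langle\cdot,\cdot\rangle$, Levi-Civita connection $\overline\nabla$ and curvature tensor $\overline R(X,Y)Z=\overline\nabla_X\overline\nabla_YZ-\overline\nabla_Y\overline\nabla_XZ-\overline\nabla_{[X,Y]}Z$. Let $L$ be a smooth immersed hypersurface of $M$ (of dimension $n$, with the induced metric) with a smooth unit normal field $N$; let $^\top$ denote the orthogonal projection onto $TL$, and let $\nabla$ denote both the induced connection $\nabla_XY=(\overline\nabla_XY)^\top$ on $L$ and the gradient of functions on $L$. Let $A(X)=-(\overline\nabla_XN)^\top$ be the shape operator, $S_r$ the $r$-th elementary symmetric function of the eigenvalues of $A$ (so $S_0=1$ and $S_r=0$ for $r>n$), and let $T_0=I$, $T_r=S_rI-AT_{r-1}$ for $r\ge 1$ be the Newton transformations. For $f\in C^\infty(L)$ put $\operatorname{Hess}f\,(X)=\nabla_X\nabla f$ and $$J_rf=\operatorname{Tr}(T_r\circ\operatorname{Hess}f)+\operatorname{Tr}(A^2T_r)\,f+\operatorname{Tr}(\overline R(N)T_r)\,f,\qquad \overline R(N)(X)=\overline R(X,N)N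 .$$ Let $U$ be a Killing field on $M$, that is, a smooth vector field with $\mathcal L_U\langle\cdot,\cdot\rangle=0$, and let $f=\langle U,N\rangle$ on $L$. Then, for every integer $r\ge 0$, the functions $f$ and $S_{r+1}$ are smooth on $L$ and $$J_r(f)=-U^\top(S_{r+1})=-\langle\nabla S_{r+1},U\rangle\qquad\text{on } L .$$ -/

import Mathlib

open Bundle Manifold VectorField
open scoped ContDiff Manifold

set_option linter.unusedSectionVars false

noncomputable section HypersurfaceDefs

namespace HypersurfaceGeometry

section LeviCivita

variable {E : Type*} [NormedAddCommGroup E] [NormedSpace ℝ E] [FiniteDimensional ℝ E]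
  {H : Type*} [TopologicalSpace H] {I : ModelWithCorners ℝ E H}
  {M : Type*} [TopologicalSpace M] [ChartedSpace H M] [IsManifold I ∞ M]
  [RiemannianBundle (fun x : M ↦ TangentSpace I x)]
  [IsContMDiffRiemannianBundle I ∞ E (fun x : M ↦ TangentSpace I x)]

variable (I) in
/-- The Koszul expression of three vector fields at `p`. For the Levi-Civita connection it equals
`2 ⟨∇_X Y, Z⟩`. -/
def koszul (X Y Z : Π x : M, TangentSpace I x) (p : M) : ℝ :=
  mvfderiv I (fun q ↦ inner ℝ (Y q) (Z q)) p (X p)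
    + mvfderiv I (fun q ↦ inner ℝ (X q) (Z q)) p (Y p)
    - mvfderiv I (fun q ↦ inner ℝ (X q) (Y q)) p (Z p)
    + inner ℝ (mlieBracket I X Y p) (Z p)
    - inner ℝ (mlieBracket I X Z p) (Y p)
    - inner ℝ (mlieBracket I Y Z p) (X p)

theorem mdifferentiableAt_inner {X Y : Π x : M, TangentSpace I x} {p : M}
    (hX : MDiffAt (T% X) p) (hY : MDiffAt (T% Y) p) :
    MDiffAt (fun q ↦ (inner ℝ (X q) (Y q) : ℝ)) p := by
  refine MDifferentiableAt.inner_bundle (E := fun x : M ↦ TangentSpace I x) (F := E) (IB := I)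
    (b := fun q ↦ q) (v := X) (w := Y) ?_ ?_
  · exact hX
  · exact hY

theorem koszul_tensorial_left {Y Z : Π x : M, TangentSpace I x} {p : M}
    (hY : MDiffAt (T% Y) p) (hZ : MDiffAt (T% Z) p) :
    TensorialAt I E (fun X ↦ koszul I X Y Z p) p where
  smul {f X} hf hX := by
    have h1 := mvfderiv_fun_mul hf (mdifferentiableAt_inner hX hZ)
    have h2 := mvfderiv_fun_mul hf (mdifferentiableAt_inner hX hY)
    simp [koszul, inner_smul_left, h1, h2, mlieBracket_smul_left hf hX, inner_add_left, inner_smul_right]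
    ring
  add {X X'} hX hX' := by
    have h1 := mvfderiv_fun_add (mdifferentiableAt_inner hX hZ) (mdifferentiableAt_inner hX' hZ)
    have h2 := mvfderiv_fun_add (mdifferentiableAt_inner hX hY) (mdifferentiableAt_inner hX' hY)
    simp [koszul, h1, h2, mlieBracket_add_left hX hX', inner_add_left, inner_add_right]
    ring


theorem koszul_tensorial_right {X Y : Π x : M, TangentSpace I x} {p : M}
    (hX : MDiffAt (T% X) p) (hY : MDiffAt (T% Y) p) :
    TensorialAt I E (fun Z ↦ koszul I X Y Z p) p where
  smul {f Z} hf hZ := by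
    have h1 := mvfderiv_fun_mul hf (mdifferentiableAt_inner hX hZ)
    have h2 := mvfderiv_fun_mul hf (mdifferentiableAt_inner hY hZ)
    simp [koszul, inner_smul_right, h1, h2, mlieBracket_smul_right hf hZ, inner_add_left,
      inner_smul_left, real_inner_comm (Z p)]
    ring
  add {Z Z'} hZ hZ' := by
    have h1 := mvfderiv_fun_add (mdifferentiableAt_inner hX hZ) (mdifferentiableAt_inner hX hZ')
    have h2 := mvfderiv_fun_add (mdifferentiableAt_inner hY hZ) (mdifferentiableAt_inner hY hZ')
    simp [koszul, h1, h2, mlieBracket_add_right hZ hZ', inner_add_left, inner_add_right]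
    ring

theorem koszul_add {X Y Y' Z : Π x : M, TangentSpace I x} {p : M}
    (hX : MDiffAt (T% X) p) (hY : MDiffAt (T% Y) p) (hY' : MDiffAt (T% Y') p)
    (hZ : MDiffAt (T% Z) p) :
    koszul I X (Y + Y') Z p = koszul I X Y Z p + koszul I X Y' Z p := by
  have h1 := mvfderiv_fun_add (mdifferentiableAt_inner hX hY) (mdifferentiableAt_inner hX hY')
  have h2 := mvfderiv_fun_add (mdifferentiableAt_inner hY hZ) (mdifferentiableAt_inner hY' hZ)
  simp [koszul, h1, h2, mlieBracket_add_right hY hY', mlieBracket_add_left hY hY',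
    inner_add_left, inner_add_right]
  ring

theorem koszul_smul {X Y Z : Π x : M, TangentSpace I x} {f : M → ℝ} {p : M}
    (hX : MDiffAt (T% X) p) (hY : MDiffAt (T% Y) p) (hZ : MDiffAt (T% Z) p) (hf : MDiffAt f p) :
    koszul I X (f • Y) Z p
      = f p * koszul I X Y Z p + 2 * mvfderiv I f p (X p) * inner ℝ (Y p) (Z p) := by
  have h1 := mvfderiv_fun_mul hf (mdifferentiableAt_inner hX hY)
  have h2 := mvfderiv_fun_mul hf (mdifferentiableAt_inner hY hZ)
  simp [koszul, h1, h2, mlieBracket_smul_right hf hY, mlieBracket_smul_left hf hY,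
    inner_smul_left, inner_smul_right, inner_add_left]
  rw [real_inner_comm (Y p) (X p)]
  ring

theorem koszul_sub {X Y Z : Π x : M, TangentSpace I x} {p : M} :
    koszul I X Y Z p - koszul I Y X Z p = 2 * inner ℝ (mlieBracket I X Y p) (Z p) := by
  rw [koszul, koszul, mlieBracket_swap_apply (V := Y) (W := X)]
  simp only [real_inner_comm, inner_neg_left]
  ring

theorem koszul_add_swap {X Y Z : Π x : M, TangentSpace I x} {p : M} :
    koszul I X Y Z p + koszul I X Z Y p
      = 2 * mvfderiv I (fun q ↦ (inner ℝ (Y q) (Z q) : ℝ)) p (X p) := by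
  rw [koszul, koszul, mlieBracket_swap_apply (V := Z) (W := Y)]
  simp only [fun q ↦ real_inner_comm (Y q) (Z q), inner_neg_left]
  ring

instance (p : M) : FiniteDimensional ℝ (TangentSpace I p) :=
  inferInstanceAs (FiniteDimensional ℝ E)

/-- A bilinear form on a tangent space is represented by an endomorphism. -/
theorem exists_riesz (p : M) (φ : TangentSpace I p →L[ℝ] TangentSpace I p →L[ℝ] ℝ) :
    ∃ A : TangentSpace I p →L[ℝ] TangentSpace I p, ∀ v w, inner ℝ (A v) w = φ v w := by
  have hB : (innerₗ (TangentSpace I p) : LinearMap.BilinForm ℝ (TangentSpace I p)).Nondegenerate := by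
    refine ⟨fun v hv ↦ ?_, fun v hv ↦ ?_⟩ <;> exact inner_self_eq_zero.1 (hv v)
  refine ⟨LinearMap.toContinuousLinearMap
    ((LinearMap.BilinForm.toDual _ hB).symm.toLinearMap ∘ₗ
      (ContinuousLinearMap.coeLM ℝ ∘ₗ φ.toLinearMap)), fun v w ↦ ?_⟩
  exact LinearMap.BilinForm.apply_toDual_symm_apply (hB := hB) _ w

theorem ext_inner {p : M} {u v : TangentSpace I p}
    (h : ∀ Z : Π x : M, TangentSpace I x, MDiffAt (T% Z) p →
      (inner ℝ u (Z p) : ℝ) = inner ℝ v (Z p)) : u = v := by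
  refine ext_inner_right ℝ fun w ↦ ?_
  have := h (FiberBundle.extend E w) (FiberBundle.mdifferentiableAt_extend ..)
  simpa using this

theorem exists_koszul :
    ∃ D : (Π x : M, TangentSpace I x) → Π x : M, TangentSpace I x →L[ℝ] TangentSpace I x,
      ∀ (p : M) (X Y Z : Π x : M, TangentSpace I x), MDiffAt (T% X) p → MDiffAt (T% Y) p →
        MDiffAt (T% Z) p → 2 * inner ℝ (D Y p (X p)) (Z p) = koszul I X Y Z p := by
  have key : ∀ (Y : Π x : M, TangentSpace I x) (p : M),
      ∃ A : TangentSpace I p →L[ℝ] TangentSpace I p, ∀ X Z : Π x : M, TangentSpace I x,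
      MDiffAt (T% X) p → MDiffAt (T% Y) p → MDiffAt (T% Z) p →
      2 * inner ℝ (A (X p)) (Z p) = koszul I X Y Z p := by
    intro Y p
    by_cases hY : MDiffAt (T% Y) p
    · obtain ⟨A, hA⟩ := exists_riesz p (TensorialAt.mkHom₂ (fun X Z ↦ koszul I X Y Z p) p
        (fun Z hZ ↦ koszul_tensorial_left hY hZ) (fun X hX ↦ koszul_tensorial_right hX hY))
      refine ⟨(1 / 2 : ℝ) • A, fun X Z hX _ hZ ↦ ?_⟩
      have h := hA (X p) (Z p)
      rw [TensorialAt.mkHom₂_apply _ _ hX hZ] at h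
      rw [← h, smul_apply, real_inner_smul_left]
      ring
    · exact ⟨0, fun _ _ _ h _ ↦ absurd h hY⟩
  choose D hD using key
  exact ⟨D, fun p X Y Z hX hY hZ ↦ hD Y p X Z hX hY hZ⟩

/-- A connection on `TM` is a Levi-Civita connection if it is torsion-free,
`∇_X Y - ∇_Y X = [X, Y]`, and metric, `X⟨Y, Z⟩ = ⟨∇_X Y, Z⟩ + ⟨Y, ∇_X Z⟩`, for differentiable vector
fields. In the argument order of Mathlib, `D Y p v` is `∇_v Y` at `p`. -/
structure IsLeviCivita (D : CovariantDerivative I E (fun x : M ↦ TangentSpace I x)) : Prop where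
  torsion_free : ∀ {p : M} {X Y : Π x : M, TangentSpace I x},
    MDiffAt (T% X) p → MDiffAt (T% Y) p →
      D Y p (X p) - D X p (Y p) = mlieBracket I X Y p
  metric : ∀ {p : M} {X Y Z : Π x : M, TangentSpace I x},
    MDiffAt (T% X) p → MDiffAt (T% Y) p → MDiffAt (T% Z) p →
      mvfderiv I (fun q ↦ (inner ℝ (Y q) (Z q) : ℝ)) p (X p)
        = inner ℝ (D Y p (X p)) (Z p) + inner ℝ (Y p) (D Z p (X p))

/-- On a smooth Riemannian manifold there is a torsion-free metric connection. -/
theorem exists_leviCivita :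
    ∃ D : CovariantDerivative I E (fun x : M ↦ TangentSpace I x), IsLeviCivita D := by
  obtain ⟨D, hD⟩ := exists_koszul (I := I) (M := M)
  have hcov : IsCovariantDerivativeOn E D Set.univ := by
    constructor
    · intro Y Y' p hY hY' _
      ext1 v
      refine ext_inner fun Z hZ ↦ ?_
      have hX := FiberBundle.mdifferentiableAt_extend I E v
      have h := koszul_add hX hY hY' hZ
      have hs := mdifferentiableAt_add_section hY hY'
      rw [← hD p _ _ Z hX hY hZ, ← hD p _ _ Z hX hY' hZ, ← hD p _ _ Z hX hs hZ,
        FiberBundle.extend_apply_self] at h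
      rw [add_apply, inner_add_left]
      linarith
    · intro Y f p hY hf _
      ext1 v
      refine ext_inner fun Z hZ ↦ ?_
      have hX := FiberBundle.mdifferentiableAt_extend I E v
      have h := koszul_smul hX hY hZ hf
      have hs := hf.smul_section hY
      rw [← hD p _ _ Z hX hY hZ, ← hD p _ _ Z hX hs hZ, FiberBundle.extend_apply_self] at h
      rw [add_apply, inner_add_left, smul_apply,
        ContinuousLinearMap.smulRight_apply, real_inner_smul_left, real_inner_smul_left]
      linarith
  refine ⟨⟨D, hcov⟩, ?_, ?_⟩
  · intro p X Y hX hY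
    refine ext_inner fun Z hZ ↦ ?_
    have h := koszul_sub (X := X) (Y := Y) (Z := Z) (p := p)
    rw [← hD p _ _ Z hX hY hZ, ← hD p _ _ Z hY hX hZ] at h
    rw [inner_sub_left]
    change inner ℝ (D Y p (X p)) (Z p) - inner ℝ (D X p (Y p)) (Z p) = _
    linarith
  · intro p X Y Z hX hY hZ
    have h := koszul_add_swap (X := X) (Y := Y) (Z := Z) (p := p)
    rw [← hD p _ _ Z hX hY hZ, ← hD p _ _ Y hX hZ hY] at h
    change _ = inner ℝ (D Y p (X p)) (Z p) + inner ℝ (Y p) (D Z p (X p))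
    rw [real_inner_comm (D Z p (X p)) (Y p)]
    linarith

variable (I M) in
/-- The Levi-Civita connection of the Riemannian manifold `M`, that is, the torsion-free connection
compatible with the metric (its values on differentiable vector fields are uniquely determined);
`leviCivita I M Y p v` is `∇_v Y` at `p`. -/
def leviCivita : CovariantDerivative I E (fun x : M ↦ TangentSpace I x) :=
  exists_leviCivita.choose

theorem isLeviCivita_leviCivita : IsLeviCivita (leviCivita I M) :=
  exists_leviCivita.choose_spec

/-- The curvature `R(X, Y) Z = ∇_X ∇_Y Z - ∇_Y ∇_X Z - ∇_[X, Y] Z` of the Levi-Civita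
connection, evaluated on vector fields. -/
def curvature (X Y Z : Π x : M, TangentSpace I x) (p : M) : TangentSpace I p :=
  leviCivita I M (fun q ↦ leviCivita I M Z q (Y q)) p (X p)
    - leviCivita I M (fun q ↦ leviCivita I M Z q (X q)) p (Y p)
    - leviCivita I M Z p (mlieBracket I X Y p)

/-- The curvature tensor `R(x, y) z` on tangent vectors at `p`: the vectors are extended to vector
fields that are smooth near `p` (the result does not depend on the smooth extensions). -/
def curvatureAt (p : M) (x y z : TangentSpace I p) : TangentSpace I p :=
  curvature (FiberBundle.extend E x) (FiberBundle.extend E y) (FiberBundle.extend E z) p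

/-- A Killing field: a smooth vector field `U` with vanishing Lie derivative of the metric,
`(𝓛_U g)(X, Y) = U⟨X, Y⟩ - ⟨[U, X], Y⟩ - ⟨X, [U, Y]⟩ = 0`. -/
structure IsKilling (U : Π x : M, TangentSpace I x) : Prop where
  contMDiff : ContMDiff I I.tangent ∞ (fun x ↦ (⟨x, U x⟩ : TangentBundle I M))
  lieDerivative_eq_zero : ∀ (p : M) (X Y : Π x : M, TangentSpace I x),
    ContMDiffAt I I.tangent ∞ (fun x ↦ (⟨x, X x⟩ : TangentBundle I M)) p →
    ContMDiffAt I I.tangent ∞ (fun x ↦ (⟨x, Y x⟩ : TangentBundle I M)) p →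
    mvfderiv I (fun q ↦ (inner ℝ (X q) (Y q) : ℝ)) p (U p)
      - inner ℝ (mlieBracket I U X p) (Y p) - inner ℝ (X p) (mlieBracket I U Y p) = 0

end LeviCivita

variable {n : ℕ}
  {L : Type*} [TopologicalSpace L] [ChartedSpace (EuclideanSpace ℝ (Fin n)) L]
  [IsManifold (𝓡 n) ∞ L]
  {M : Type*} [TopologicalSpace M] [ChartedSpace (EuclideanSpace ℝ (Fin (n + 1))) M]
  [IsManifold (𝓡 (n + 1)) ∞ M]
  [RiemannianBundle (fun x : M ↦ TangentSpace (𝓡 (n + 1)) x)]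
  [IsContMDiffRiemannianBundle (𝓡 (n + 1)) ∞ (EuclideanSpace ℝ (Fin (n + 1)))
    (fun x : M ↦ TangentSpace (𝓡 (n + 1)) x)]

variable (n L M) in
/-- A smooth immersed hypersurface `L → M` (an embedded one being the special case of an
inclusion), of dimension `n` in a manifold of dimension `n + 1`, together with a smooth unit normal
field `N` along it. -/
structure OrientedHypersurface where
  toFun : L → M
  contMDiff : ContMDiff (𝓡 n) (𝓡 (n + 1)) ∞ toFun
  injective_mfderiv : ∀ q : L, Function.Injective (mfderiv (𝓡 n) (𝓡 (n + 1)) toFun q)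
  normal : Π q : L, TangentSpace (𝓡 (n + 1)) (toFun q)
  contMDiff_normal : ContMDiff (𝓡 n) (𝓡 (n + 1)).tangent ∞
    (fun q ↦ (⟨toFun q, normal q⟩ : TangentBundle (𝓡 (n + 1)) M))
  inner_normal_self : ∀ q : L, (inner ℝ (normal q) (normal q) : ℝ) = 1
  inner_mfderiv_normal : ∀ (q : L) (v : TangentSpace (𝓡 n) q),
    (inner ℝ (mfderiv (𝓡 n) (𝓡 (n + 1)) toFun q v) (normal q) : ℝ) = 0

namespace OrientedHypersurface

variable (S : OrientedHypersurface n L M)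

/-- The differential of the immersion; it identifies `T_q L` with a subspace of `T_q M`. -/
def diff (q : L) : TangentSpace (𝓡 n) q →ₗ[ℝ] TangentSpace (𝓡 (n + 1)) (S.toFun q) :=
  (mfderiv (𝓡 n) (𝓡 (n + 1)) S.toFun q).toLinearMap

/-- The induced metric on `L`. -/
def metric (q : L) : LinearMap.BilinForm ℝ (TangentSpace (𝓡 n) q) :=
  (innerₗ (TangentSpace (𝓡 (n + 1)) (S.toFun q))).compl₁₂ (S.diff q) (S.diff q)

theorem metric_nondegenerate (q : L) : (S.metric q).Nondegenerate := by
  have h : ∀ v, S.metric q v v = 0 → v = 0 := fun v hv ↦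
    S.injective_mfderiv q (by rw [map_zero]; exact inner_self_eq_zero.1 hv)
  exact ⟨fun v hv ↦ h v (hv v), fun v hv ↦ h v (hv v)⟩

/-- The tangential part `w^⊤ ∈ T_q L` of a vector `w` of the ambient manifold at `q`: the vector
with `⟨w^⊤, v⟩ = ⟨w, v⟩` for all `v ∈ T_q L`. -/
def tang (q : L) : TangentSpace (𝓡 (n + 1)) (S.toFun q) →ₗ[ℝ] TangentSpace (𝓡 n) q :=
  ((S.metric q).toDual (S.metric_nondegenerate q)).symm.toLinearMap ∘ₗ
    (innerₗ (TangentSpace (𝓡 (n + 1)) (S.toFun q))).compl₂ (S.diff q)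

/-- The ambient covariant derivative `v ↦ ∇_v V` of a field `V` of ambient tangent vectors along
the hypersurface. With respect to the local frame `∂ᵢ` of `TM` given by the preferred trivialization
at `q`, write `V = ∑ uⁱ ∂ᵢ`; then `∇_v V = ∑ duⁱ(v) ∂ᵢ + ∑ uⁱ(q) ∇_v ∂ᵢ`, and the second sum is the
Levi-Civita derivative of `∑ uⁱ(q) ∂ᵢ`, which is the extension of `V q` with constant
coefficients. -/
def covAlong (V : Π q : L, TangentSpace (𝓡 (n + 1)) (S.toFun q)) (q : L) :
    TangentSpace (𝓡 n) q →ₗ[ℝ] TangentSpace (𝓡 (n + 1)) (S.toFun q) :=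
  let e := trivializationAt (EuclideanSpace ℝ (Fin (n + 1)))
    (fun x : M ↦ TangentSpace (𝓡 (n + 1)) x) (S.toFun q)
  (e.symmL ℝ (S.toFun q)).toLinearMap ∘ₗ
      (mvfderiv (𝓡 n) (fun q' ↦ (e ⟨S.toFun q', V q'⟩).2) q).toLinearMap
    + (leviCivita (𝓡 (n + 1)) M
        (FiberBundle.extend (EuclideanSpace ℝ (Fin (n + 1))) (V q)) (S.toFun q)).toLinearMap
      ∘ₗ S.diff q

/-- The shape operator `A v = -(∇_v N)^⊤`. -/
def shape (q : L) : Module.End ℝ (TangentSpace (𝓡 n) q) :=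
  -(S.tang q ∘ₗ S.covAlong S.normal q)

/-- The `r`-th mean curvature `S_r`: the `r`-th elementary symmetric function of the principal
curvatures, which are the eigenvalues of `A` counted with multiplicity. In particular `S_0 = 1` and
`S_r = 0` for `r > n`. -/
def meanCurv (r : ℕ) (q : L) : ℝ := (S.shape q).charpoly.roots.esymm r

/-- The Newton transformations `T_0 = I`, `T_r = S_r I - A T_{r-1}`. -/
def newton (q : L) : ℕ → Module.End ℝ (TangentSpace (𝓡 n) q)
  | 0 => 1
  | r + 1 => S.meanCurv (r + 1) q • 1 - S.shape q * newton q r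

/-- The gradient of a function on `L` with respect to the induced metric. -/
def grad (f : L → ℝ) (q : L) : TangentSpace (𝓡 n) q :=
  ((S.metric q).toDual (S.metric_nondegenerate q)).symm (mvfderiv (𝓡 n) f q).toLinearMap

/-- The connection of `L` induced by the ambient one: `v ↦ (∇_v Y)^⊤` for a tangent field `Y`. -/
def cov (Y : Π q : L, TangentSpace (𝓡 n) q) (q : L) : Module.End ℝ (TangentSpace (𝓡 n) q) :=
  S.tang q ∘ₗ S.covAlong (fun q' ↦ S.diff q' (Y q')) q

/-- The Hessian of `f` on `L` as an operator, `v ↦ ∇_v (grad f)`. -/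
def hess (f : L → ℝ) (q : L) : Module.End ℝ (TangentSpace (𝓡 n) q) := S.cov (S.grad f) q

/-- The operator `v ↦ R(v, N) N` on `T_q L`, as the linear map with these values on a basis.
The projection only moves `R(v, N) N`, which is orthogonal to `N`, into `T_q L`. -/
def normalCurv (q : L) : Module.End ℝ (TangentSpace (𝓡 n) q) :=
  (Module.finBasis ℝ (TangentSpace (𝓡 n) q)).constr ℝ fun i ↦
    S.tang q (curvatureAt (S.toFun q) (S.diff q (Module.finBasis ℝ (TangentSpace (𝓡 n) q) i))
      (S.normal q) (S.normal q))

/-- `L_r f = Tr (T_r ∘ Hess f)`. -/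
def opL (r : ℕ) (f : L → ℝ) (q : L) : ℝ :=
  LinearMap.trace ℝ (TangentSpace (𝓡 n) q) (S.newton q r * S.hess f q)

/-- `J_r f = L_r f + Tr (A² T_r) f + Tr (R(N) T_r) f`. -/
def opJ (r : ℕ) (f : L → ℝ) (q : L) : ℝ :=
  S.opL r f q
    + LinearMap.trace ℝ (TangentSpace (𝓡 n) q) (S.shape q ^ 2 * S.newton q r) * f q
    + LinearMap.trace ℝ (TangentSpace (𝓡 n) q) (S.normalCurv q * S.newton q r) * f q

end OrientedHypersurface
end HypersurfaceGeometry

end HypersurfaceDefs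

/-!
The proof is a computation of the Hessian of the support function `f = ⟨U, N⟩`, carried out in
charts, where the ambient manifold is an open set with a metric and its Christoffel symbols and the
hypersurface is an immersion `ψ` with unit normal `ν`, shape operator `A` and
`U ∘ ψ = ψ' T + f ν`, so that `T` is the tangential part of `U`.

Let `K = ∇U`. The Killing equation says that `K` is skew for the metric. Since `∇_v ν = -ψ' (A v)`,
differentiating `f` gives `grad f = -K ν - ψ' (A T)`, which is tangential because `K` is skew
(`locField_grad_support`). A Killing field also satisfies `(∇_a K) b = -R(U, a) b`
(`IsChristoffel.covDerivEnd_covDifferential_of_killing`), hence the covariant derivative of `grad f`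
involves no derivative of `K`. With the Codazzi equation the terms combine to
(`IsChristoffel.covDeriv_gradient_support`, `hess_support`)
`Hess f = [dT, A] - d_T A - f A² - f R(·, N) N`,
where `d` is the coordinate derivative; the first two terms are minus the Lie derivative of `A`
along `T`.

Now the trace is taken against the Newton transformation `T_r`. It commutes with `A`, so the
commutator contributes nothing, and `Tr (T_r ∘ d_T A)` is the derivative of `S_{r+1}` in the
direction `T` by the first variation formula `dS_{r+1}(h) = Tr (T_r h)` (`fderiv_traceSymm_succ`,
`mvfderiv_meanCurv_succ`). The two remaining terms cancel those of zeroth order in `J_r f`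
(`opJ_support`).

The first variation formula and the smoothness of `S_r` are proved without eigenvalues: Newton's
identity `(k + 1) S_{k+1} = Tr (A T_k)` is used as a recursive definition of `S_k` and `T_k`, which
is polynomial in `A` (`traceSymm`, `traceNewton`). It agrees with the symmetric functions of the
roots of the characteristic polynomial because `A` is self-adjoint, hence diagonalizable
(`esymm_roots_charpoly_eq_traceSymm`).
-/

namespace HypersurfaceGeometry

/-! ### Newton transformations in an algebra with a trace -/

section NewtonAlgebra

variable {R : Type*} [Ring R] [Algebra ℝ R] (τ : R →ₗ[ℝ] ℝ) (a : R)

/-- The pair consisting of the `k`-th elementary symmetric function and the `k`-th Newton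
transformation of an element `a` of an algebra with a trace `τ`. The symmetric functions are defined
by Newton's identity `(k + 1) S_{k+1} = τ (a T_k)`, which makes sense without eigenvalues and is
visibly polynomial in `a`. -/
noncomputable def newtonPair : ℕ → ℝ × R
  | 0 => (1, 1)
  | k + 1 => (τ (a * (newtonPair k).2) / (k + 1),
      (τ (a * (newtonPair k).2) / (k + 1)) • 1 - a * (newtonPair k).2)

/-- The `k`-th elementary symmetric function of `a` with respect to the trace `τ`. -/
noncomputable def traceSymm (k : ℕ) : ℝ := (newtonPair τ a k).1

/-- The `k`-th Newton transformation of `a` with respect to the trace `τ`. -/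
noncomputable def traceNewton (k : ℕ) : R := (newtonPair τ a k).2

@[simp] theorem traceSymm_zero : traceSymm τ a 0 = 1 := rfl

@[simp] theorem traceNewton_zero : traceNewton τ a 0 = 1 := rfl

theorem traceSymm_succ (k : ℕ) :
    traceSymm τ a (k + 1) = τ (a * traceNewton τ a k) / (k + 1) := rfl

theorem traceNewton_succ (k : ℕ) :
    traceNewton τ a (k + 1) = traceSymm τ a (k + 1) • 1 - a * traceNewton τ a k := rfl

theorem succ_mul_traceSymm_succ (k : ℕ) :
    ((k : ℝ) + 1) * traceSymm τ a (k + 1) = τ (a * traceNewton τ a k) := by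
  rw [traceSymm_succ]
  field_simp

theorem commute_traceNewton (k : ℕ) : Commute a (traceNewton τ a k) := by
  induction k with
  | zero => exact Commute.one_right a
  | succ k ih =>
    rw [traceNewton_succ]
    exact ((Commute.one_right a).smul_right _).sub_right ((Commute.refl a).mul_right ih)

theorem traceNewton_eq_sum (k : ℕ) :
    traceNewton τ a k
      = ∑ j ∈ Finset.range (k + 1), ((-1) ^ j * traceSymm τ a (k - j)) • a ^ j := by
  induction k with
  | zero => simp
  | succ k ih =>
    rw [traceNewton_succ, Finset.sum_range_succ', ih, Finset.mul_sum, sub_eq_neg_add,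
      ← Finset.sum_neg_distrib]
    congr 1
    · refine Finset.sum_congr rfl fun j _ ↦ ?_
      rw [Nat.add_sub_add_right, mul_smul_comm, ← pow_succ', ← neg_smul]
      congr 1
      ring
    · simp

theorem map_newtonPair {R' : Type*} [Ring R'] [Algebra ℝ R'] (τ' : R' →ₗ[ℝ] ℝ) (φ : R →ₐ[ℝ] R')
    (h : ∀ b, τ' (φ b) = τ b) (k : ℕ) :
    newtonPair τ' (φ a) k = ((newtonPair τ a k).1, φ (newtonPair τ a k).2) := by
  induction k with
  | zero => simp [newtonPair]
  | succ k ih => simp [newtonPair, ih, ← map_mul, h]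

theorem traceSymm_map {R' : Type*} [Ring R'] [Algebra ℝ R'] (τ' : R' →ₗ[ℝ] ℝ) (φ : R →ₐ[ℝ] R')
    (h : ∀ b, τ' (φ b) = τ b) (k : ℕ) : traceSymm τ' (φ a) k = traceSymm τ a k := by
  rw [traceSymm, map_newtonPair τ a τ' φ h]
  rfl

theorem traceNewton_map {R' : Type*} [Ring R'] [Algebra ℝ R'] (τ' : R' →ₗ[ℝ] ℝ) (φ : R →ₐ[ℝ] R')
    (h : ∀ b, τ' (φ b) = τ b) (k : ℕ) : traceNewton τ' (φ a) k = φ (traceNewton τ a k) := by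
  rw [traceNewton, map_newtonPair τ a τ' φ h]
  rfl

/-- The element `W_k(c)` such that `τ (c · dT_k(h)) = τ (W_k(c) · h)` for `c` commuting with `a`. -/
noncomputable def newtonAdj : ℕ → R → R
  | 0, _ => 0
  | k + 1, c => τ c • traceNewton τ a k - c * traceNewton τ a k - newtonAdj k (c * a)

theorem newtonAdj_succ (k : ℕ) (c : R) :
    newtonAdj τ a (k + 1) c
      = τ c • traceNewton τ a k - c * traceNewton τ a k - newtonAdj τ a k (c * a) := rfl

/-- A second recursion for `W_k`, obtained by expanding the Newton transformations instead of the
argument. -/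
theorem newtonAdj_succ' (k : ℕ) {c : R} (hc : Commute a c) :
    newtonAdj τ a (k + 1) c
      = τ (c * traceNewton τ a k) • 1 - c * traceNewton τ a k - a * newtonAdj τ a k c := by
  induction k generalizing c with
  | zero => simp [newtonAdj]
  | succ k ih =>
    have h1 := ih (c := c * a) (hc.mul_right (Commute.refl a))
    have h2 : τ (c * traceNewton τ a (k + 1))
        = traceSymm τ a (k + 1) * τ c - τ (c * a * traceNewton τ a k) := by
      rw [traceNewton_succ, mul_sub, mul_smul_comm, mul_one, map_sub, map_smul, smul_eq_mul,
        mul_assoc]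
    have h3 : a * traceNewton τ a k = traceSymm τ a (k + 1) • 1 - traceNewton τ a (k + 1) := by
      rw [traceNewton_succ]; abel
    rw [newtonAdj_succ, h1, h2, newtonAdj_succ τ a k c, mul_sub, mul_sub, mul_smul_comm, h3,
      ← mul_assoc a c, hc.eq]
    module

theorem newtonAdj_self (k : ℕ) : newtonAdj τ a k a = (k : ℝ) • traceNewton τ a k := by
  induction k with
  | zero => simp [newtonAdj]
  | succ k ih =>
    rw [newtonAdj_succ' τ a k (Commute.refl a), ih, ← succ_mul_traceSymm_succ, mul_smul,
      mul_smul_comm, traceNewton_succ]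
    push_cast
    module

/-- The linear recursion satisfied by the derivatives `σ_k` and `δ_k` of `S_k` and `T_k` in the
direction `h` forces `σ_{k+1} = τ (T_k h)`. -/
theorem deriv_traceSymm_of_recursion (hτ : ∀ b c, τ (b * c) = τ (c * b)) (h : R) (σ : ℕ → ℝ)
    (δ : ℕ → R) (hδ0 : δ 0 = 0)
    (hσ : ∀ k : ℕ, ((k : ℝ) + 1) * σ (k + 1) = τ (h * traceNewton τ a k + a * δ k))
    (hδ : ∀ k, δ (k + 1) = σ (k + 1) • 1 - (h * traceNewton τ a k + a * δ k)) (k : ℕ) :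
    σ (k + 1) = τ (traceNewton τ a k * h) := by
  induction k using Nat.strong_induction_on with
  | _ k ih =>
    have key : ∀ m ≤ k, ∀ c, Commute a c → τ (c * δ m) = τ (newtonAdj τ a m c * h) := by
      intro m
      induction m with
      | zero => intro _ c _; simp [newtonAdj, hδ0]
      | succ m ihm =>
        intro hm c hc
        have h1 := ihm (by omega) (c * a) (hc.mul_right (Commute.refl a))
        have h2 : τ (c * (h * traceNewton τ a m)) = τ (c * traceNewton τ a m * h) := by
          rw [← mul_assoc, hτ (c * h), ← mul_assoc]
          congr 2
          have : ∀ m, Commute c (traceNewton τ a m) := by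
            intro m
            rw [traceNewton_eq_sum]
            exact Commute.sum_right _ _ _ fun j _ ↦ (hc.symm.pow_right j).smul_right _
          exact (this m).eq.symm
        rw [hδ, ih m (by omega), newtonAdj_succ, mul_sub, mul_add, map_sub, map_add, h2,
          ← mul_assoc c a, h1, mul_smul_comm, mul_one, map_smul, sub_mul, sub_mul, map_sub, map_sub,
          smul_mul_assoc, map_smul, smul_eq_mul, smul_eq_mul]
        ring
    have h1 := hσ k
    rw [map_add, key k le_rfl a (Commute.refl a), newtonAdj_self, smul_mul_assoc, map_smul,
      hτ h, smul_eq_mul] at h1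
    have h2 : ((k : ℝ) + 1) ≠ 0 := by positivity
    refine mul_left_cancel₀ h2 ?_
    rw [h1]
    ring

end NewtonAlgebra

section NewtonCalculus

variable {R : Type*} [NormedRing R] [NormedAlgebra ℝ R] (τ : R →L[ℝ] ℝ)

theorem contDiff_newtonPair (k : ℕ) : ContDiff ℝ ∞ fun a ↦ newtonPair (τ : R →ₗ[ℝ] ℝ) a k := by
  induction k with
  | zero => exact contDiff_const
  | succ k ih =>
    have h1 : ContDiff ℝ ∞ fun a ↦ a * (newtonPair (τ : R →ₗ[ℝ] ℝ) a k).2 :=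
      contDiff_id.mul ih.snd
    have h2 : ContDiff ℝ ∞ fun a ↦ τ (a * (newtonPair (τ : R →ₗ[ℝ] ℝ) a k).2) / (k + 1) :=
      (τ.contDiff.comp h1).div_const _
    exact h2.prodMk ((h2.smul contDiff_const).sub h1)

theorem contDiff_traceSymm (k : ℕ) : ContDiff ℝ ∞ fun a ↦ traceSymm (τ : R →ₗ[ℝ] ℝ) a k :=
  (contDiff_newtonPair τ k).fst

theorem contDiff_traceNewton (k : ℕ) : ContDiff ℝ ∞ fun a ↦ traceNewton (τ : R →ₗ[ℝ] ℝ) a k :=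
  (contDiff_newtonPair τ k).snd

/-- The first variation of the elementary symmetric functions, `dS_{k+1}(h) = Tr (T_k h)`. -/
theorem fderiv_traceSymm_succ (hτ : ∀ b c, τ (b * c) = τ (c * b)) (k : ℕ) (a h : R) :
    fderiv ℝ (fun a ↦ traceSymm (τ : R →ₗ[ℝ] ℝ) a (k + 1)) a h
      = τ (traceNewton (τ : R →ₗ[ℝ] ℝ) a k * h) := by
  have dS (k : ℕ) := ((contDiff_traceSymm τ k).differentiable (by simp) a).hasFDerivAt
  have dT (k : ℕ) := ((contDiff_traceNewton τ k).differentiable (by simp) a).hasFDerivAt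
  have dP (k : ℕ) := (hasFDerivAt_id (𝕜 := ℝ) a).mul' (dT k)
  refine deriv_traceSymm_of_recursion (τ : R →ₗ[ℝ] ℝ) a hτ h
    (fun k ↦ fderiv ℝ (fun a ↦ traceSymm (τ : R →ₗ[ℝ] ℝ) a k) a h)
    (fun k ↦ fderiv ℝ (fun a ↦ traceNewton (τ : R →ₗ[ℝ] ℝ) a k) a h) ?_ ?_ ?_ k
  · simp [traceNewton, newtonPair]
  · intro k
    have h1 := (τ.hasFDerivAt.comp a (dP k)).congr_of_eventuallyEq
      (f₁ := fun a ↦ ((k : ℝ) + 1) * traceSymm (τ : R →ₗ[ℝ] ℝ) a (k + 1))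
      (Filter.Eventually.of_forall fun b ↦ succ_mul_traceSymm_succ (τ : R →ₗ[ℝ] ℝ) b k)
    have h2 := ((dS (k + 1)).const_mul ((k : ℝ) + 1)).unique h1
    have h3 := congrArg (fun φ ↦ φ h) h2
    simpa [add_comm] using h3
  · intro k
    have h1 := ((dS (k + 1)).smul_const (1 : R)).sub (dP k)
    have h2 := (dT (k + 1)).unique h1
    have h3 := congrArg (fun φ ↦ φ h) h2
    simpa [add_comm] using h3

end NewtonCalculus

/-! ### Symmetric functions of the eigenvalues of a symmetric operator -/

section Spectral

variable {V : Type*} [AddCommGroup V] [Module ℝ V] [FiniteDimensional ℝ V]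

/-- An operator that is symmetric for some positive definite form is diagonalizable. -/
theorem exists_basis_eigenvectors (B : LinearMap.BilinForm ℝ V) (hsymm : ∀ v w, B v w = B w v)
    (hpos : ∀ v, v ≠ 0 → 0 < B v v) (A : Module.End ℝ V) (hA : ∀ v w, B (A v) w = B v (A w)) :
    ∃ (b : Module.Basis (Fin (Module.finrank ℝ V)) ℝ V) (μ : Fin (Module.finrank ℝ V) → ℝ),
      ∀ i, A (b i) = μ i • b i := by
  let core : InnerProductSpace.Core ℝ V :=
    { inner := fun v w ↦ B v w
      conj_inner_symm := fun v w ↦ by simpa using hsymm w v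
      re_inner_nonneg := fun v ↦ by
        by_cases hv : v = 0
        · simp [hv]
        · simpa using (hpos v hv).le
      add_left := fun u v w ↦ by simp
      smul_left := fun u v r ↦ by simp
      definite := fun v hv ↦ by
        by_contra h
        exact (hpos v h).ne' hv }
  let _ := core.toNormedAddCommGroup
  let _ := InnerProductSpace.ofCore core.toCore
  have hS : A.IsSymmetric := fun v w ↦ hA v w
  exact ⟨(hS.eigenvectorBasis rfl).toBasis, hS.eigenvalues rfl, fun i ↦ by
    simp⟩

theorem toMatrix_eq_diagonal {ι : Type*} [Fintype ι] [DecidableEq ι] (b : Module.Basis ι ℝ V)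
    (A : Module.End ℝ V) (μ : ι → ℝ) (hb : ∀ i, A (b i) = μ i • b i) :
    LinearMap.toMatrix b b A = Matrix.diagonal μ := by
  ext i j
  rw [LinearMap.toMatrix_apply, hb, map_smul, Module.Basis.repr_self, Matrix.diagonal_apply]
  by_cases h : i = j
  · subst h; simp
  · simp [h]

/-- Both sides satisfy Newton's identities for the power sums `Tr (A ^ j)`. -/
theorem esymm_roots_charpoly_eq_traceSymm (B : LinearMap.BilinForm ℝ V)
    (hsymm : ∀ v w, B v w = B w v) (hpos : ∀ v, v ≠ 0 → 0 < B v v) (A : Module.End ℝ V)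
    (hA : ∀ v w, B (A v) w = B v (A w)) (k : ℕ) :
    A.charpoly.roots.esymm k = traceSymm (LinearMap.trace ℝ V) A k := by
  obtain ⟨b, μ, hb⟩ := exists_basis_eigenvectors B hsymm hpos A hA
  have hroots : A.charpoly.roots = Multiset.map μ Finset.univ.val := by
    rw [← LinearMap.charpoly_toMatrix A b, toMatrix_eq_diagonal b A μ hb, Matrix.charpoly_diagonal,
      Polynomial.roots_prod _ _ (by simp [Finset.prod_ne_zero_iff, Polynomial.X_sub_C_ne_zero])]
    simp
  have hpow (j : ℕ) : LinearMap.trace ℝ V (A ^ j) = ∑ i, μ i ^ j := by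
    have hbj : ∀ i, (A ^ j) (b i) = μ i ^ j • b i := by
      intro i
      induction j with
      | zero => simp
      | succ j ih => rw [pow_succ, Module.End.mul_apply, hb, map_smul, ih, smul_smul, pow_succ']
    rw [LinearMap.trace_eq_matrix_trace ℝ b, toMatrix_eq_diagonal b _ _ hbj, Matrix.trace_diagonal]
  rw [hroots, ← MvPolynomial.aeval_esymm_eq_multiset_esymm (Fin (Module.finrank ℝ V)) ℝ]
  induction k using Nat.strong_induction_on with
  | _ k ih =>
    rcases k with _ | k
    · simp [MvPolynomial.esymm_zero]
    have hN := congrArg (MvPolynomial.aeval μ)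
      (MvPolynomial.mul_esymm_eq_sum (Fin (Module.finrank ℝ V)) ℝ (k + 1))
    have hS := succ_mul_traceSymm_succ (LinearMap.trace ℝ V) A k
    rw [traceNewton_eq_sum, Finset.mul_sum, map_sum, ← Finset.sum_range_reflect] at hS
    rw [Finset.sum_filter, Finset.Nat.sum_antidiagonal_eq_sum_range_succ_mk,
      Finset.sum_range_succ] at hN
    simp only [lt_irrefl, if_false, add_zero, map_mul, map_natCast, map_pow, map_neg, map_one,
      map_sum] at hN
    have h0 : ((k : ℝ) + 1) ≠ 0 := by positivity
    refine mul_left_cancel₀ h0 ?_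
    rw [hS]
    push_cast at hN
    rw [hN, Finset.mul_sum]
    refine Finset.sum_congr rfl fun j hj ↦ ?_
    rw [Finset.mem_range] at hj
    rw [if_pos hj, mul_smul_comm, map_smul, ← pow_succ', hpow]
    simp only [map_mul, map_pow, map_neg, map_one, MvPolynomial.psum, map_sum, MvPolynomial.aeval_X,
      smul_eq_mul]
    rw [ih j hj]
    have e1 : k + 1 - 1 - j = k - j := by omega
    have e2 : k - (k - j) = j := by omega
    have e3 : k - j + 1 = k + 1 - j := by omega
    rw [e1, e2, e3, ← mul_assoc, ← mul_assoc, ← pow_add]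
    congr 2
    have e4 : k + 1 + 1 + j = (k - j) + 2 * (j + 1) := by omega
    rw [e4, pow_add, pow_mul]
    simp

end Spectral

/-! ### Covariant derivatives in coordinates -/

theorem two_le_infty : (2 : WithTop ℕ∞) ≤ ∞ := by norm_cast

theorem one_add_one_le_infty : (1 + 1 : WithTop ℕ∞) ≤ ∞ := by norm_cast

section LocalCalculus

set_option maxSynthPendingDepth 3

variable {E F : Type*} [NormedAddCommGroup E] [NormedSpace ℝ E]
  [NormedAddCommGroup F] [NormedSpace ℝ F]

/-- The covariant derivative of a field `V` along a map `ψ : E → F`, in the direction `v`, for the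
connection on `F` with Christoffel symbols `Γ`. -/
noncomputable def covDeriv (Γ : F → F →L[ℝ] F →L[ℝ] F) (ψ V : E → F) (x v : E) : F :=
  fderiv ℝ V x v + Γ (ψ x) (fderiv ℝ ψ x v) (V x)

/-- The curvature of the connection with Christoffel symbols `Γ`. -/
noncomputable def localCurv (Γ : F → F →L[ℝ] F →L[ℝ] F) (y a b c : F) : F :=
  fderiv ℝ Γ y a b c - fderiv ℝ Γ y b a c + Γ y a (Γ y b c) - Γ y b (Γ y a c)

/-- The covariant derivative of a field `K` of endomorphisms. -/
noncomputable def covDerivEnd (Γ : F → F →L[ℝ] F →L[ℝ] F) (K : F → F →L[ℝ] F) (y a b : F) : F :=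
  fderiv ℝ K y a b + Γ y a (K y b) - K y (Γ y a b)

/-- The covariant differential `a ↦ ∇_a u` of a vector field `u`. -/
noncomputable def covDifferential (Γ : F → F →L[ℝ] F →L[ℝ] F) (u : F → F) (y : F) : F →L[ℝ] F :=
  fderiv ℝ u y + (Γ y).flip (u y)

theorem covDifferential_apply (Γ : F → F →L[ℝ] F →L[ℝ] F) (u : F → F) (y a : F) :
    covDifferential Γ u y a = fderiv ℝ u y a + Γ y a (u y) := rfl

variable {Γ : F → F →L[ℝ] F →L[ℝ] F} {ψ V V' : E → F} {x : E}

theorem fderiv_clm_apply_const {G : Type*} [NormedAddCommGroup G] [NormedSpace ℝ G]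
    {L : E → F →L[ℝ] G} (hL : DifferentiableAt ℝ L x) (c : F) (v : E) :
    fderiv ℝ (fun z ↦ L z c) x v = fderiv ℝ L x v c := by
  rw [fderiv_clm_apply hL (differentiableAt_const c)]
  simp

theorem covDeriv_congr (h : V =ᶠ[nhds x] V') (v : E) :
    covDeriv Γ ψ V x v = covDeriv Γ ψ V' x v := by
  rw [covDeriv, covDeriv, h.fderiv_eq, h.eq_of_nhds]

theorem covDeriv_add (hV : DifferentiableAt ℝ V x) (hV' : DifferentiableAt ℝ V' x) (v : E) :
    covDeriv Γ ψ (fun z ↦ V z + V' z) x v = covDeriv Γ ψ V x v + covDeriv Γ ψ V' x v := by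
  simp only [covDeriv, fderiv_fun_add hV hV', map_add, add_apply]
  abel

theorem covDeriv_neg (v : E) :
    covDeriv Γ ψ (fun z ↦ -V z) x v = -covDeriv Γ ψ V x v := by
  simp only [covDeriv, fderiv_fun_neg, map_neg, neg_apply]
  abel

theorem covDeriv_smul {f : E → ℝ} (hf : DifferentiableAt ℝ f x) (hV : DifferentiableAt ℝ V x)
    (v : E) :
    covDeriv Γ ψ (fun z ↦ f z • V z) x v = fderiv ℝ f x v • V x + f x • covDeriv Γ ψ V x v := by
  simp only [covDeriv, fderiv_fun_smul hf hV, map_smul, add_apply, smul_apply,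
    ContinuousLinearMap.smulRight_apply]
  module

theorem covDeriv_comp {u : F → F} (hu : DifferentiableAt ℝ u (ψ x)) (hψ : DifferentiableAt ℝ ψ x)
    (v : E) :
    covDeriv Γ ψ (fun z ↦ u (ψ z)) x v = covDifferential Γ u (ψ x) (fderiv ℝ ψ x v) := by
  rw [covDeriv, covDifferential_apply, fderiv_fun_comp x hu hψ]
  rfl

theorem covDeriv_clm_apply {K : F → F →L[ℝ] F} (hK : DifferentiableAt ℝ K (ψ x))
    (hψ : DifferentiableAt ℝ ψ x) (hV : DifferentiableAt ℝ V x) (v : E) :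
    covDeriv Γ ψ (fun z ↦ K (ψ z) (V z)) x v
      = covDerivEnd Γ K (ψ x) (fderiv ℝ ψ x v) (V x) + K (ψ x) (covDeriv Γ ψ V x v) := by
  have h1 : DifferentiableAt ℝ (fun z ↦ K (ψ z)) x := hK.comp x hψ
  simp only [covDeriv, covDerivEnd, fderiv_clm_apply h1 hV, fderiv_fun_comp x hK hψ, map_add,
    add_apply, ContinuousLinearMap.comp_apply, ContinuousLinearMap.flip_apply]
  abel

/-- Differentiating a tangential field `x ↦ ψ'(x) (c x)`: its coefficients may be frozen up to the
term `ψ' (dc)`. -/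
theorem covDeriv_fderiv_apply {c : E → E} (hψ : ContDiffAt ℝ 2 ψ x) (hc : DifferentiableAt ℝ c x)
    (v : E) :
    covDeriv Γ ψ (fun z ↦ fderiv ℝ ψ z (c z)) x v
      = covDeriv Γ ψ (fun z ↦ fderiv ℝ ψ z (c x)) x v + fderiv ℝ ψ x (fderiv ℝ c x v) := by
  have h1 : DifferentiableAt ℝ (fderiv ℝ ψ) x :=
    (hψ.fderiv_right (m := 1) (by norm_num)).differentiableAt one_ne_zero
  simp only [covDeriv, fderiv_clm_apply h1 hc,
    fderiv_clm_apply h1 (differentiableAt_const (c x)), fderiv_fun_const]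
  simp
  abel

/-- The connection is torsion-free: coordinate fields of an immersion satisfy
`∇_v ∂_w = ∇_w ∂_v`. -/
theorem covDeriv_fderiv_comm (hψ : ContDiffAt ℝ 2 ψ x) (hΓ : ∀ a b, Γ (ψ x) a b = Γ (ψ x) b a)
    (v w : E) :
    covDeriv Γ ψ (fun z ↦ fderiv ℝ ψ z w) x v = covDeriv Γ ψ (fun z ↦ fderiv ℝ ψ z v) x w := by
  have h1 : DifferentiableAt ℝ (fderiv ℝ ψ) x :=
    (hψ.fderiv_right (m := 1) (by norm_num)).differentiableAt one_ne_zero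
  have h2 := (hψ.isSymmSndFDerivAt (by simp)).eq v w
  simp only [covDeriv, fderiv_clm_apply h1 (differentiableAt_const _), fderiv_fun_const]
  simp [h2, hΓ (fderiv ℝ ψ x v)]

/-- The curvature is the commutator of covariant derivatives along coordinate directions. -/
theorem covDeriv_covDeriv_sub (hψ : ContDiffAt ℝ 2 ψ x) (hV : ContDiffAt ℝ 2 V x)
    (hΓ : DifferentiableAt ℝ Γ (ψ x)) (v w : E) :
    covDeriv Γ ψ (fun z ↦ covDeriv Γ ψ V z w) x v - covDeriv Γ ψ (fun z ↦ covDeriv Γ ψ V z v) x w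
      = localCurv Γ (ψ x) (fderiv ℝ ψ x v) (fderiv ℝ ψ x w) (V x) := by
  have hψ0 : DifferentiableAt ℝ ψ x := hψ.differentiableAt two_ne_zero
  have hV0 : DifferentiableAt ℝ V x := hV.differentiableAt two_ne_zero
  have hψ1 : DifferentiableAt ℝ (fderiv ℝ ψ) x :=
    (hψ.fderiv_right (m := 1) (by norm_num)).differentiableAt one_ne_zero
  have hV1 : DifferentiableAt ℝ (fderiv ℝ V) x :=
    (hV.fderiv_right (m := 1) (by norm_num)).differentiableAt one_ne_zero
  have hΓψ : DifferentiableAt ℝ (fun z ↦ Γ (ψ z)) x := hΓ.comp x hψ0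
  have key (v w : E) : covDeriv Γ ψ (fun z ↦ covDeriv Γ ψ V z w) x v
      = fderiv ℝ (fderiv ℝ V) x v w
        + (fderiv ℝ Γ (ψ x) (fderiv ℝ ψ x v) (fderiv ℝ ψ x w) (V x)
          + Γ (ψ x) (fderiv ℝ (fderiv ℝ ψ) x v w) (V x)
          + Γ (ψ x) (fderiv ℝ ψ x w) (fderiv ℝ V x v))
        + Γ (ψ x) (fderiv ℝ ψ x v) (fderiv ℝ V x w + Γ (ψ x) (fderiv ℝ ψ x w) (V x)) := by
    have d1 : DifferentiableAt ℝ (fun z ↦ fderiv ℝ ψ z w) x :=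
      hψ1.clm_apply (differentiableAt_const w)
    have d2 : DifferentiableAt ℝ (fun z ↦ fderiv ℝ V z w) x :=
      hV1.clm_apply (differentiableAt_const w)
    have d3 : DifferentiableAt ℝ (fun z ↦ Γ (ψ z) (fderiv ℝ ψ z w)) x := hΓψ.clm_apply d1
    have d4 : DifferentiableAt ℝ (fun z ↦ Γ (ψ z) (fderiv ℝ ψ z w) (V z)) x := d3.clm_apply hV0
    simp only [covDeriv]
    rw [fderiv_fun_add d2 d4, fderiv_clm_apply d3 hV0, fderiv_clm_apply hΓψ d1,
      fderiv_fun_comp x hΓ hψ0]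
    simp only [add_apply, ContinuousLinearMap.comp_apply, ContinuousLinearMap.flip_apply,
      fderiv_clm_apply_const hV1, fderiv_clm_apply_const hψ1]
    abel
  rw [key, key, (hψ.isSymmSndFDerivAt (by simp)).eq w v, (hV.isSymmSndFDerivAt (by simp)).eq w v,
    localCurv]
  simp only [map_add]
  abel

/-- `Γ` are the Christoffel symbols of the Levi-Civita connection of the Riemannian metric `g` on
the open set `W`. -/
structure IsChristoffel (W : Set F) (g : F → F →L[ℝ] F →L[ℝ] ℝ) (Γ : F → F →L[ℝ] F →L[ℝ] F) :
    Prop where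
  isOpen : IsOpen W
  contDiffOn_metric : ContDiffOn ℝ ∞ g W
  contDiffOn : ContDiffOn ℝ ∞ Γ W
  metric_symm : ∀ y ∈ W, ∀ a b, g y a b = g y b a
  metric_pos : ∀ y ∈ W, ∀ a, a ≠ 0 → 0 < g y a a
  symm : ∀ y ∈ W, ∀ a b, Γ y a b = Γ y b a
  compat : ∀ y ∈ W, ∀ a b c, fderiv ℝ g y a b c = g y (Γ y a b) c + g y b (Γ y a c)

namespace IsChristoffel

variable {W : Set F} {g : F → F →L[ℝ] F →L[ℝ] ℝ} (h : IsChristoffel W g Γ)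
include h

theorem contDiffAt {y : F} (hy : y ∈ W) : ContDiffAt ℝ ∞ Γ y :=
  h.contDiffOn.contDiffAt (h.isOpen.mem_nhds hy)

theorem contDiffAt_metric {y : F} (hy : y ∈ W) : ContDiffAt ℝ ∞ g y :=
  h.contDiffOn_metric.contDiffAt (h.isOpen.mem_nhds hy)

theorem differentiableAt {y : F} (hy : y ∈ W) : DifferentiableAt ℝ Γ y :=
  (h.contDiffAt hy).differentiableAt (by simp)

theorem differentiableAt_metric {y : F} (hy : y ∈ W) : DifferentiableAt ℝ g y :=
  (h.contDiffAt_metric hy).differentiableAt (by simp)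

theorem eq_of_metric_eq {y : F} (hy : y ∈ W) {a b : F} (hab : ∀ c, g y a c = g y b c) : a = b := by
  by_contra hne
  have := h.metric_pos y hy (a - b) (sub_ne_zero.2 hne)
  rw [map_sub (g y) a b, sub_apply, hab, sub_self] at this
  exact lt_irrefl _ this

theorem fderiv_metric (hx : ψ x ∈ W) (hψ : DifferentiableAt ℝ ψ x) (hV : DifferentiableAt ℝ V x)
    (hV' : DifferentiableAt ℝ V' x) (v : E) :
    fderiv ℝ (fun z ↦ g (ψ z) (V z) (V' z)) x v
      = g (ψ x) (covDeriv Γ ψ V x v) (V' x) + g (ψ x) (V x) (covDeriv Γ ψ V' x v) := by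
  have hg := h.differentiableAt_metric hx
  have d1 : DifferentiableAt ℝ (fun z ↦ g (ψ z)) x := hg.comp x hψ
  rw [fderiv_clm_apply (d1.clm_apply hV) hV', fderiv_clm_apply d1 hV, fderiv_fun_comp x hg hψ]
  simp [covDeriv, h.compat _ hx]
  abel

theorem localCurv_cyclic {y : F} (hy : y ∈ W) (a b c : F) :
    localCurv Γ y a b c + localCurv Γ y b c a + localCurv Γ y c a b = 0 := by
  have hd (a b c : F) : fderiv ℝ Γ y a b c = fderiv ℝ Γ y a c b := by
    have d := h.differentiableAt hy
    have h1 (b c : F) : fderiv ℝ (fun z ↦ Γ z b c) y a = fderiv ℝ Γ y a b c := by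
      rw [fderiv_clm_apply_const (d.clm_apply (differentiableAt_const b)),
        fderiv_clm_apply_const d]
    rw [← h1, ← h1]
    congr 1
    refine Filter.EventuallyEq.fderiv_eq ?_
    filter_upwards [h.isOpen.mem_nhds hy] with z hz using h.symm z hz b c
  have s := h.symm y hy
  simp only [localCurv]
  rw [hd a b c, hd b a c, hd c b a, s b c, s a c, s a b]
  abel

theorem localCurv_skew_right {y : F} (hy : y ∈ W) (a b c d : F) :
    g y (localCurv Γ y a b c) d + g y c (localCurv Γ y a b d) = 0 := by
  have hΓ := h.differentiableAt hy
  have key (a b : F) : fderiv ℝ (fderiv ℝ g) y a b c d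
      = g y (covDeriv Γ id (fun z ↦ covDeriv Γ id (fun _ ↦ c) z b) y a) d
        + g y (Γ y b c) (Γ y a d) + g y (Γ y a c) (Γ y b d)
        + g y c (covDeriv Γ id (fun z ↦ covDeriv Γ id (fun _ ↦ d) z b) y a) := by
    have hconst (c : F) : ∀ z, covDeriv Γ id (fun _ ↦ c) z b = Γ z b c := by
      intro z; simp [covDeriv]
    have dΓ (c : F) : DifferentiableAt ℝ (fun z ↦ Γ z b c) y :=
      (hΓ.clm_apply (differentiableAt_const b)).clm_apply (differentiableAt_const c)
    have h1 := h.fderiv_metric (ψ := id) (x := y) hy differentiableAt_id (dΓ c)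
      (differentiableAt_const d) a
    have h2 := h.fderiv_metric (ψ := id) (x := y) hy differentiableAt_id
      (differentiableAt_const c) (dΓ d) a
    have dg1 : DifferentiableAt ℝ (fderiv ℝ g) y :=
      ((h.contDiffAt_metric hy).fderiv_right (m := 1) one_add_one_le_infty).differentiableAt
        one_ne_zero
    have h3 : fderiv ℝ (fun z ↦ fderiv ℝ g z b c d) y a = fderiv ℝ (fderiv ℝ g) y a b c d := by
      rw [fderiv_clm_apply_const ((dg1.clm_apply (differentiableAt_const b)).clm_apply
        (differentiableAt_const c)),
        fderiv_clm_apply_const (dg1.clm_apply (differentiableAt_const b)),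
        fderiv_clm_apply_const dg1]
    have h4 : (fun z ↦ fderiv ℝ g z b c d)
        =ᶠ[nhds y] fun z ↦ g (id z) (Γ z b c) d + g (id z) c (Γ z b d) := by
      filter_upwards [h.isOpen.mem_nhds hy] with z hz using h.compat z hz b c d
    have dg := h.differentiableAt_metric hy
    have d1 : DifferentiableAt ℝ (fun z ↦ g (id z) (Γ z b c) d) y :=
      (dg.clm_apply (dΓ c)).clm_apply (differentiableAt_const d)
    have d2 : DifferentiableAt ℝ (fun z ↦ g (id z) c (Γ z b d)) y :=
      (dg.clm_apply (differentiableAt_const c)).clm_apply (dΓ d)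
    rw [← h3, h4.fderiv_eq, fderiv_fun_add d1 d2, add_apply, h1, h2]
    simp only [hconst]
    simp [covDeriv]
    abel
  have hsymm := (((h.contDiffAt_metric hy).of_le two_le_infty).isSymmSndFDerivAt (by simp)).eq a b
  have h1 (c : F) : covDeriv Γ id (fun z ↦ covDeriv Γ id (fun _ ↦ c) z b) y a
      - covDeriv Γ id (fun z ↦ covDeriv Γ id (fun _ ↦ c) z a) y b = localCurv Γ y a b c := by
    simpa using covDeriv_covDeriv_sub (Γ := Γ) (ψ := id) (V := fun _ ↦ c) (x := y)
      contDiffAt_id contDiffAt_const hΓ a b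
  have hs := congrArg (fun φ ↦ φ c d) hsymm
  simp only [key] at hs
  rw [← h1 c, ← h1 d]
  simp only [map_sub, sub_apply]
  linarith

/-- A trilinear form that is skew in the last two arguments is determined by its skew part in the
first two; applied to `⟨(∇_a K) b, c⟩` and `-⟨R(u, a) b, c⟩`, with `K = ∇u`, this gives the formula
for the second covariant derivative of a Killing field. -/
theorem covDerivEnd_covDifferential_of_killing {u : F → F} (hu : ContDiffOn ℝ ∞ u W)
    (hK : ∀ y ∈ W, ∀ a b, g y (covDifferential Γ u y a) b + g y a (covDifferential Γ u y b) = 0)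
    {y : F} (hy : y ∈ W) (a b : F) :
    covDerivEnd Γ (covDifferential Γ u) y a b = -localCurv Γ y (u y) a b := by
  have hΓ := h.differentiableAt hy
  have hua : ContDiffAt ℝ ∞ u y := hu.contDiffAt (h.isOpen.mem_nhds hy)
  have hu0 : DifferentiableAt ℝ u y := hua.differentiableAt (by simp)
  have hu1 : DifferentiableAt ℝ (fderiv ℝ u) y :=
    (hua.fderiv_right (m := 1) one_add_one_le_infty).differentiableAt one_ne_zero
  have hflip : DifferentiableAt ℝ (fun z ↦ (Γ z).flip) y :=
    (ContinuousLinearMap.flipₗᵢ ℝ F F F).toContinuousLinearEquiv.toContinuousLinearMap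
      |>.differentiableAt.comp y hΓ
  have hKd : DifferentiableAt ℝ (covDifferential Γ u) y := hu1.add (hflip.clm_apply hu0)
  have hKc (b : F) : DifferentiableAt ℝ (fun z ↦ covDifferential Γ u z b) y :=
    hKd.clm_apply (differentiableAt_const b)
  have hcov (a b : F) : covDeriv Γ id (fun z ↦ covDifferential Γ u z b) y a
      = covDerivEnd Γ (covDifferential Γ u) y a b + covDifferential Γ u y (Γ y a b) := by
    have := covDeriv_clm_apply (Γ := Γ) (ψ := id) (x := y) (K := covDifferential Γ u)
      (V := fun _ ↦ b) hKd differentiableAt_id (differentiableAt_const b) a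
    simpa [covDeriv] using this
  have skew (a b c : F) : g y (covDerivEnd Γ (covDifferential Γ u) y a b) c
      + g y b (covDerivEnd Γ (covDifferential Γ u) y a c) = 0 := by
    have h1 := h.fderiv_metric (ψ := id) (x := y) hy differentiableAt_id (hKc b)
      (differentiableAt_const c) a
    have h2 := h.fderiv_metric (ψ := id) (x := y) hy differentiableAt_id
      (differentiableAt_const b) (hKc c) a
    have dg := h.differentiableAt_metric hy
    have d1 : DifferentiableAt ℝ (fun z ↦ g (id z) (covDifferential Γ u z b) c) y :=
      (dg.clm_apply (hKc b)).clm_apply (differentiableAt_const c)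
    have d2 : DifferentiableAt ℝ (fun z ↦ g (id z) b (covDifferential Γ u z c)) y :=
      (dg.clm_apply (differentiableAt_const b)).clm_apply (hKc c)
    have h3 : (fun z ↦ g (id z) (covDifferential Γ u z b) c
        + g (id z) b (covDifferential Γ u z c)) =ᶠ[nhds y] fun _ ↦ 0 := by
      filter_upwards [h.isOpen.mem_nhds hy] with z hz using hK z hz b c
    have h4 : fderiv ℝ (fun z ↦ g (id z) (covDifferential Γ u z b) c
        + g (id z) b (covDifferential Γ u z c)) y a = 0 := by
      rw [h3.fderiv_eq]; simp
    rw [fderiv_fun_add d1 d2, add_apply, h1, h2, hcov, hcov] at h4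
    have k1 := hK y hy (Γ y a b) c
    have k2 := hK y hy b (Γ y a c)
    simp [covDeriv] at h4
    linarith
  have ricci (a b : F) : covDerivEnd Γ (covDifferential Γ u) y a b
      - covDerivEnd Γ (covDifferential Γ u) y b a = localCurv Γ y a b (u y) := by
    have h1 := covDeriv_covDeriv_sub (Γ := Γ) (ψ := id) (V := u) (x := y)
      contDiffAt_id (hua.of_le two_le_infty) hΓ a b
    have h2 (b : F) : ∀ z, covDeriv Γ id u z b = covDifferential Γ u z b := by
      intro z; simp [covDeriv, covDifferential_apply]
    simp only [h2, hcov] at h1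
    rw [h.symm y hy b a, add_sub_add_right_eq_sub] at h1
    simpa using h1
  have skewR := h.localCurv_skew_right hy
  have swapR (a b c : F) : localCurv Γ y a b c = -localCurv Γ y b a c := by
    simp only [localCurv]; abel
  let D : F → F → F → ℝ := fun a b c ↦
    g y (covDerivEnd Γ (covDifferential Γ u) y a b + localCurv Γ y (u y) a b) c
  have D1 (a b c : F) : D a b c = -D a c b := by
    have e1 := skew a b c
    have e2 := skewR (u y) a b c
    simp only [D, map_add, add_apply]
    rw [h.metric_symm y hy _ b, h.metric_symm y hy _ b]
    linarith
  have D2 (a b c : F) : D a b c = D b a c := by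
    have e1 := ricci a b
    have e2 := h.localCurv_cyclic hy (u y) a b
    rw [swapR b (u y) a] at e2
    simp only [D]
    congr 2
    rw [sub_eq_iff_eq_add.1 e1]
    have : localCurv Γ y a b (u y) = localCurv Γ y (u y) b a - localCurv Γ y (u y) a b := by
      rw [← sub_eq_zero, ← e2]; abel
    rw [this]
    abel
  have D0 (a b c : F) : D a b c = 0 := by
    have e1 := D1 a b c
    have e2 := D2 a c b
    have e3 := D1 c a b
    have e4 := D2 c b a
    have e5 := D1 b c a
    have e6 := D2 b a c
    linarith
  rw [eq_neg_iff_add_eq_zero]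
  refine h.eq_of_metric_eq hy fun c ↦ ?_
  rw [map_zero, zero_apply]
  exact D0 a b c

/-- The derivative of the gradient of the support function `f` of a Killing field `u` along an
immersion `ψ` with unit normal `ν` and shape operator `A`. If `u = ψ' T + f ν`, then
`grad f = -∇_ν u - A T`, and by the Codazzi equation and the formula for the second derivative of
`u`, its tangential covariant derivative is `[dT, A] - d_T A - f A² - f R(·, ν) ν`. The commutator
minus `d_T A` is minus the Lie derivative of `A` in the direction `T`. -/
theorem covDeriv_gradient_support {u : F → F} (hu : ContDiffOn ℝ ∞ u W)
    (hK : ∀ y ∈ W, ∀ a b, g y (covDifferential Γ u y a) b + g y a (covDifferential Γ u y b) = 0)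
    {ν : E → F} {T : E → E} {A : E → E →L[ℝ] E} {f : E → ℝ} (hx : ψ x ∈ W)
    (hψ : ContDiffAt ℝ ∞ ψ x) (hν : ContDiffAt ℝ ∞ ν x) (hT : DifferentiableAt ℝ T x)
    (hA : DifferentiableAt ℝ A x) (hf : DifferentiableAt ℝ f x)
    (hshape : ∀ᶠ z in nhds x, ∀ v, covDeriv Γ ψ ν z v = -fderiv ℝ ψ z (A z v))
    (hdecomp : ∀ᶠ z in nhds x, u (ψ z) = fderiv ℝ ψ z (T z) + f z • ν z) (v : E) :
    covDeriv Γ ψ (fun z ↦ -covDifferential Γ u (ψ z) (ν z) - fderiv ℝ ψ z (A z (T z))) x v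
      = fderiv ℝ ψ x (fderiv ℝ T x (A x v) - A x (fderiv ℝ T x v) - f x • A x (A x v)
          - fderiv ℝ A x (T x) v)
        + fderiv ℝ f x (A x v) • ν x - f x • localCurv Γ (ψ x) (fderiv ℝ ψ x v) (ν x) (ν x) := by
  have hΓ := h.differentiableAt hx
  have hua : ContDiffAt ℝ ∞ u (ψ x) := hu.contDiffAt (h.isOpen.mem_nhds hx)
  have hu0 : DifferentiableAt ℝ u (ψ x) := hua.differentiableAt (by simp)
  have hu1 : DifferentiableAt ℝ (fderiv ℝ u) (ψ x) :=
    (hua.fderiv_right (m := 1) one_add_one_le_infty).differentiableAt one_ne_zero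
  have hflip : DifferentiableAt ℝ (fun z ↦ (Γ z).flip) (ψ x) :=
    (ContinuousLinearMap.flipₗᵢ ℝ F F F).toContinuousLinearEquiv.toContinuousLinearMap
      |>.differentiableAt.comp (ψ x) hΓ
  have hKd : DifferentiableAt ℝ (covDifferential Γ u) (ψ x) := hu1.add (hflip.clm_apply hu0)
  have hψ2 : ContDiffAt ℝ 2 ψ x := hψ.of_le two_le_infty
  have hν2 : ContDiffAt ℝ 2 ν x := hν.of_le two_le_infty
  have hψ0 : DifferentiableAt ℝ ψ x := hψ.differentiableAt (by simp)
  have hν0 : DifferentiableAt ℝ ν x := hν.differentiableAt (by simp)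
  have hψ1 : DifferentiableAt ℝ (fderiv ℝ ψ) x :=
    (hψ.fderiv_right (m := 1) one_add_one_le_infty).differentiableAt one_ne_zero
  have dAT : DifferentiableAt ℝ (fun z ↦ A z (T z)) x := hA.clm_apply hT
  have dAc (w : E) : DifferentiableAt ℝ (fun z ↦ A z w) x := hA.clm_apply (differentiableAt_const w)
  have hshape0 := hshape.self_of_nhds
  -- the Codazzi equation, with the tangent vector `T x` frozen
  have codazzi : covDeriv Γ ψ (fun z ↦ fderiv ℝ ψ z (A z (T x))) x v
      = covDeriv Γ ψ (fun z ↦ fderiv ℝ ψ z (A z v)) x (T x)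
        + localCurv Γ (ψ x) (fderiv ℝ ψ x (T x)) (fderiv ℝ ψ x v) (ν x) := by
    have h1 := covDeriv_covDeriv_sub (Γ := Γ) hψ2 hν2 hΓ (T x) v
    have h2 (w w' : E) : covDeriv Γ ψ (fun z ↦ covDeriv Γ ψ ν z w) x w'
        = -covDeriv Γ ψ (fun z ↦ fderiv ℝ ψ z (A z w)) x w' := by
      rw [← covDeriv_neg]
      refine covDeriv_congr ?_ w'
      filter_upwards [hshape] with z hz using hz w
    rw [h2, h2] at h1
    rw [← h1]
    abel
  have e1 : covDeriv Γ ψ (fun z ↦ fderiv ℝ ψ z (A z (T z))) x v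
      = covDeriv Γ ψ (fun z ↦ fderiv ℝ ψ z (A z (T x))) x v
        + fderiv ℝ ψ x (A x (fderiv ℝ T x v)) := by
    rw [covDeriv_fderiv_apply hψ2 dAT, covDeriv_fderiv_apply hψ2 (dAc (T x)),
      fderiv_clm_apply hA hT, fderiv_clm_apply hA (differentiableAt_const (T x))]
    simp
    abel
  have e2 : covDeriv Γ ψ (fun z ↦ fderiv ℝ ψ z (A z v)) x (T x)
      = covDeriv Γ ψ (fun z ↦ fderiv ℝ ψ z (T x)) x (A x v)
        + fderiv ℝ ψ x (fderiv ℝ A x (T x) v) := by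
    rw [covDeriv_fderiv_apply hψ2 (dAc v), covDeriv_fderiv_comm hψ2 (h.symm _ hx) (T x) (A x v),
      fderiv_clm_apply hA (differentiableAt_const v)]
    simp
  have e3 (w : E) : covDifferential Γ u (ψ x) (fderiv ℝ ψ x w)
      = covDeriv Γ ψ (fun z ↦ fderiv ℝ ψ z (T x)) x w + fderiv ℝ ψ x (fderiv ℝ T x w)
        + (fderiv ℝ f x w • ν x - f x • fderiv ℝ ψ x (A x w)) := by
    rw [← covDeriv_comp hu0 hψ0, covDeriv_congr hdecomp,
      covDeriv_add (V' := fun z ↦ f z • ν z) (hψ1.clm_apply hT) (hf.smul hν0),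
      covDeriv_fderiv_apply hψ2 hT, covDeriv_smul hf hν0, hshape0]
    simp
    abel
  have e4 : covDeriv Γ ψ (fun z ↦ covDifferential Γ u (ψ z) (ν z)) x v
      = -localCurv Γ (ψ x) (u (ψ x)) (fderiv ℝ ψ x v) (ν x)
        - covDifferential Γ u (ψ x) (fderiv ℝ ψ x (A x v)) := by
    rw [covDeriv_clm_apply hKd hψ0 hν0, h.covDerivEnd_covDifferential_of_killing hu hK hx,
      hshape0, map_neg, sub_eq_add_neg]
  have e5 : localCurv Γ (ψ x) (u (ψ x)) (fderiv ℝ ψ x v) (ν x)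
      = localCurv Γ (ψ x) (fderiv ℝ ψ x (T x)) (fderiv ℝ ψ x v) (ν x)
        - f x • localCurv Γ (ψ x) (fderiv ℝ ψ x v) (ν x) (ν x) := by
    rw [hdecomp.self_of_nhds]
    simp only [localCurv, map_add, map_smul, add_apply, smul_apply]
    module
  have d1 : DifferentiableAt ℝ (fun z ↦ -covDifferential Γ u (ψ z) (ν z)) x :=
    ((hKd.comp x hψ0).clm_apply hν0).neg
  have d2 : DifferentiableAt ℝ (fun z ↦ -fderiv ℝ ψ z (A z (T z))) x := (hψ1.clm_apply dAT).neg
  simp only [sub_eq_add_neg (-covDifferential Γ u _ _)]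
  rw [covDeriv_add d1 d2, covDeriv_neg, covDeriv_neg, e4, e1, codazzi, e2, e3, e5]
  simp only [map_sub, map_smul]
  module

end IsChristoffel

end LocalCalculus

/-! ### Existence of Christoffel symbols -/

section Christoffel

set_option maxSynthPendingDepth 3

variable {E F X : Type*} [NormedAddCommGroup E] [NormedSpace ℝ E] [FiniteDimensional ℝ E]
  [NormedAddCommGroup F] [NormedSpace ℝ F] [FiniteDimensional ℝ F]
  [NormedAddCommGroup X] [NormedSpace ℝ X]

theorem isInvertible_of_pos (B : E →L[ℝ] E →L[ℝ] ℝ) (hB : ∀ v, v ≠ 0 → 0 < B v v) :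
    B.IsInvertible := by
  have hinj : Function.Injective B := by
    refine (injective_iff_map_eq_zero B).2 fun v hv ↦ ?_
    by_contra hne
    have := hB v hne
    rw [hv] at this
    exact lt_irrefl _ this
  have hdim : Module.finrank ℝ E = Module.finrank ℝ (E →L[ℝ] ℝ) := by
    rw [← (LinearMap.toContinuousLinearMap (𝕜 := ℝ) (E := E) (F' := ℝ)).finrank_eq]
    exact (Subspace.dual_finrank_eq (K := ℝ) (V := E)).symm
  exact ⟨(LinearEquiv.ofInjectiveOfFinrankEq B.toLinearMap hinj hdim).toContinuousLinearEquiv,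
    by ext; rfl⟩

/-- A vector field representing a smooth family of linear forms with respect to a smooth family of
positive definite bilinear forms is smooth. -/
theorem contDiffOn_of_represents {O : Set X} {B : X → E →L[ℝ] E →L[ℝ] ℝ} {φ : X → E →L[ℝ] ℝ}
    {s : X → E} (hB : ContDiffOn ℝ ∞ B O) (hφ : ContDiffOn ℝ ∞ φ O)
    (hpos : ∀ z ∈ O, ∀ v, v ≠ 0 → 0 < B z v v) (hs : ∀ z ∈ O, ∀ w, B z (s z) w = φ z w) :
    ContDiffOn ℝ ∞ s O := by
  have h1 : ∀ z ∈ O, s z = (B z).inverse (φ z) := fun z hz ↦ by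
    have e : φ z = B z (s z) := ContinuousLinearMap.ext fun w ↦ (hs z hz w).symm
    rw [e, (isInvertible_of_pos (B z) (hpos z hz)).inverse_apply_self]
  have h2 : ContDiffOn ℝ ∞ (fun z ↦ (B z).inverse) O := fun z hz ↦
    ((isInvertible_of_pos (B z) (hpos z hz)).contDiffAt_map_inverse).comp_contDiffWithinAt z
      (hB z hz)
  exact (h2.clm_apply hφ).congr h1

/-- The Koszul formula in coordinates. -/
theorem IsChristoffel.koszul {W : Set F} {g : F → F →L[ℝ] F →L[ℝ] ℝ}
    {Γ : F → F →L[ℝ] F →L[ℝ] F} (h : IsChristoffel W g Γ) {y : F} (hy : y ∈ W) (a b c : F) :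
    fderiv ℝ g y a b c + fderiv ℝ g y b a c - fderiv ℝ g y c a b = 2 * g y (Γ y a b) c := by
  rw [h.compat y hy, h.compat y hy, h.compat y hy, h.symm y hy b a, h.symm y hy c a,
    h.symm y hy c b, h.metric_symm y hy b]
  ring

theorem exists_isChristoffel {W : Set F} (hW : IsOpen W) {g : F → F →L[ℝ] F →L[ℝ] ℝ}
    (hg : ContDiffOn ℝ ∞ g W) (hsymm : ∀ y ∈ W, ∀ a b, g y a b = g y b a)
    (hpos : ∀ y ∈ W, ∀ a, a ≠ 0 → 0 < g y a a) :
    ∃ Γ : F → F →L[ℝ] F →L[ℝ] F, IsChristoffel W g Γ := by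
  let G : F → F →L[ℝ] F →L[ℝ] F →L[ℝ] ℝ := fun y ↦ fderiv ℝ g y
  have hG : ContDiffOn ℝ ∞ G W := hg.fderiv_of_isOpen hW (by simp)
  -- `K y a b c = (∂_a g(b, c) + ∂_b g(a, c) - ∂_c g(a, b)) / 2`
  let K : F → F →L[ℝ] F →L[ℝ] F →L[ℝ] ℝ := fun y ↦ (1 / 2 : ℝ) • (G y + (G y).flip
    - (ContinuousLinearMap.flipₗᵢ ℝ F F ℝ).toContinuousLinearEquiv.toContinuousLinearMap ∘L
      (G y).flip)
  have hK (y a b c : F) : K y a b c = (1 / 2) * (G y a b c + G y b a c - G y c a b) := by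
    simp [K]
  let Γ : F → F →L[ℝ] F →L[ℝ] F := fun y ↦
    ContinuousLinearMap.compL ℝ F (F →L[ℝ] ℝ) F (g y).inverse ∘L K y
  have hΓ (y : F) (hy : y ∈ W) (a b c : F) : g y (Γ y a b) c = K y a b c := by
    have : g y (Γ y a b) = K y a b :=
      (isInvertible_of_pos (g y) (hpos y hy)).self_apply_inverse (K y a b)
    rw [this]
  have hGs (y : F) (hy : y ∈ W) (a b c : F) : G y a b c = G y a c b := by
    have d : DifferentiableAt ℝ g y :=
      (hg.contDiffAt (hW.mem_nhds hy)).differentiableAt (by simp)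
    have h1 (b c : F) : fderiv ℝ (fun z ↦ g z b c) y a = G y a b c := by
      rw [fderiv_clm_apply_const (d.clm_apply (differentiableAt_const b)),
        fderiv_clm_apply_const d]
    rw [← h1, ← h1]
    congr 1
    refine Filter.EventuallyEq.fderiv_eq ?_
    filter_upwards [hW.mem_nhds hy] with z hz using hsymm z hz b c
  have heq (y : F) (hy : y ∈ W) {a b : F} (hab : ∀ c, g y a c = g y b c) : a = b :=
    (isInvertible_of_pos (g y) (hpos y hy)).injective (ContinuousLinearMap.ext hab)
  refine ⟨Γ, hW, hg, ?_, hsymm, hpos, ?_, ?_⟩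
  · refine contDiffOn_clm_apply.2 fun a ↦ contDiffOn_clm_apply.2 fun b ↦ ?_
    refine contDiffOn_of_represents (φ := fun y ↦ K y a b) hg ?_ hpos fun y hy c ↦ hΓ y hy a b c
    refine contDiffOn_clm_apply.2 fun c ↦ ?_
    have hGc (a b c : F) : ContDiffOn ℝ ∞ (fun y ↦ G y a b c) W :=
      ((hG.clm_apply contDiffOn_const).clm_apply contDiffOn_const).clm_apply contDiffOn_const
    simp only [hK]
    exact contDiffOn_const.mul (((hGc a b c).add (hGc b a c)).sub (hGc c a b))
  · intro y hy a b
    refine heq y hy fun c ↦ ?_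
    rw [hΓ y hy, hΓ y hy, hK, hK, hGs y hy c a b]
    ring
  · intro y hy a b c
    rw [hsymm y hy b, hΓ y hy, hΓ y hy, hK, hK, hGs y hy c a b, hGs y hy b a c, hGs y hy a b c]
    ring

end Christoffel

/-! ### Vector fields in a chart -/

section Chart

variable {F : Type*} [NormedAddCommGroup F] [NormedSpace ℝ F] [FiniteDimensional ℝ F]
  {M : Type*} [TopologicalSpace M] [ChartedSpace F M] [IsManifold 𝓘(ℝ, F) ∞ M]
  {G : Type*} [NormedAddCommGroup G] [NormedSpace ℝ G]

local notation "κ" => extChartAt (modelWithCornersSelf ℝ F)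

variable (F) in
/-- The components of a tangent vector at `p` in the chart around `p₀`. -/
noncomputable def coord (p₀ p : M) : TangentSpace 𝓘(ℝ, F) p →L[ℝ] F :=
  (trivializationAt F (TangentSpace 𝓘(ℝ, F)) p₀).continuousLinearMapAt ℝ p

/-- The tangent vector at `p` with given components in the chart around `p₀`. -/
noncomputable def ofCoord (p₀ p : M) : F →L[ℝ] TangentSpace 𝓘(ℝ, F) p :=
  (trivializationAt F (TangentSpace 𝓘(ℝ, F)) p₀).symmL ℝ p

theorem mem_baseSet {p₀ p : M} (hp : p ∈ (κ p₀).source) :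
    p ∈ (trivializationAt F (TangentSpace 𝓘(ℝ, F)) p₀).baseSet := by
  rw [TangentBundle.trivializationAt_baseSet]
  simpa using hp

theorem coord_ofCoord {p₀ p : M} (hp : p ∈ (κ p₀).source) (a : F) :
    coord F p₀ p (ofCoord p₀ p a) = a :=
  Trivialization.continuousLinearMapAt_symmL _ (mem_baseSet hp) a

theorem ofCoord_coord {p₀ p : M} (hp : p ∈ (κ p₀).source) (v : TangentSpace 𝓘(ℝ, F) p) :
    ofCoord p₀ p (coord F p₀ p v) = v :=
  Trivialization.symmL_continuousLinearMapAt _ (mem_baseSet hp) v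

theorem coord_eq_snd {p₀ p : M} (hp : p ∈ (κ p₀).source) (v : TangentSpace 𝓘(ℝ, F) p) :
    coord F p₀ p v = (trivializationAt F (TangentSpace 𝓘(ℝ, F)) p₀ ⟨p, v⟩).2 :=
  Trivialization.continuousLinearMapAt_apply_of_mem (R := ℝ)
    (trivializationAt F (TangentSpace 𝓘(ℝ, F)) p₀) (mem_baseSet hp) v

theorem coord_eq_mfderiv {p₀ p : M} (hp : p ∈ (κ p₀).source) :
    coord F p₀ p = mfderiv 𝓘(ℝ, F) 𝓘(ℝ, F) (κ p₀) p :=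
  TangentBundle.continuousLinearMapAt_trivializationAt (by simpa using hp)

theorem ofCoord_eq_mfderiv {p₀ p : M} (hp : p ∈ (κ p₀).source) :
    ofCoord (F := F) p₀ p = mfderiv 𝓘(ℝ, F) 𝓘(ℝ, F) (κ p₀).symm (κ p₀ p) := by
  have := TangentBundle.symmL_trivializationAt (I := 𝓘(ℝ, F)) (x₀ := p₀) (x := p)
    (by simpa using hp)
  rwa [ModelWithCorners.Boundaryless.range_eq_univ, mfderivWithin_univ] at this

theorem extend_eq_ofCoord {p₀ p : M} (hp : p ∈ (κ p₀).source) (v : TangentSpace 𝓘(ℝ, F) p₀) :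
    FiberBundle.extend F v p = ofCoord p₀ p (coord F p₀ p₀ v) := by
  rw [coord_eq_snd (mem_extChartAt_source p₀), ofCoord,
    Trivialization.symmL_apply _ (mem_baseSet hp)]
  rfl

theorem contMDiffAt_chart_symm {p₀ : M} {z : F} (hz : z ∈ (κ p₀).target) :
    ContMDiffAt 𝓘(ℝ, F) 𝓘(ℝ, F) ∞ (κ p₀).symm z :=
  (contMDiffOn_extChartAt_symm p₀).contMDiffAt ((isOpen_extChartAt_target p₀).mem_nhds hz)

theorem contMDiffAt_chart {p₀ p : M} (hp : p ∈ (κ p₀).source) :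
    ContMDiffAt 𝓘(ℝ, F) 𝓘(ℝ, F) ∞ (κ p₀) p :=
  contMDiffAt_extChartAt' (by simpa using hp)

theorem chart_source_mem_nhds {p₀ p : M} (hp : p ∈ (κ p₀).source) : (κ p₀).source ∈ nhds p :=
  (isOpen_extChartAt_source p₀).mem_nhds hp

theorem chart_target_mem_nhds {p₀ : M} {z : F} (hz : z ∈ (κ p₀).target) :
    (κ p₀).target ∈ nhds z :=
  (isOpen_extChartAt_target p₀).mem_nhds hz

theorem mdifferentiableAt_iff_chart {p₀ p : M} (hp : p ∈ (κ p₀).source) {f : M → G} :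
    MDifferentiableAt 𝓘(ℝ, F) 𝓘(ℝ, G) f p
      ↔ DifferentiableAt ℝ (fun z ↦ f ((κ p₀).symm z)) (κ p₀ p) := by
  have hz := (κ p₀).map_source hp
  constructor
  · intro h
    rw [← mdifferentiableAt_iff_differentiableAt]
    refine MDifferentiableAt.comp (κ p₀ p) (g := f) ?_
      ((contMDiffAt_chart_symm hz).mdifferentiableAt (by simp))
    rwa [(κ p₀).left_inv hp]
  · intro h
    have h1 : MDifferentiableAt 𝓘(ℝ, F) 𝓘(ℝ, G) (fun q ↦ f ((κ p₀).symm (κ p₀ q))) p :=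
      MDifferentiableAt.comp p (g := fun z ↦ f ((κ p₀).symm z)) h.mdifferentiableAt
        ((contMDiffAt_chart hp).mdifferentiableAt (by simp))
    refine h1.congr_of_eventuallyEq ?_
    filter_upwards [chart_source_mem_nhds hp] with q hq
    rw [(κ p₀).left_inv hq]

theorem mvfderiv_eq_fderiv_chart {p₀ p : M} (hp : p ∈ (κ p₀).source) {f : M → G}
    (hf : MDifferentiableAt 𝓘(ℝ, F) 𝓘(ℝ, G) f p) (v : TangentSpace 𝓘(ℝ, F) p) :
    mvfderiv 𝓘(ℝ, F) f p v
      = fderiv ℝ (fun z ↦ f ((κ p₀).symm z)) (κ p₀ p) (coord F p₀ p v) := by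
  have h1 : f =ᶠ[nhds p] (fun z ↦ f ((κ p₀).symm z)) ∘ κ p₀ := by
    filter_upwards [chart_source_mem_nhds hp] with q hq
    rw [Function.comp_apply, (κ p₀).left_inv hq]
  have h2 := (mdifferentiableAt_iff_chart hp).1 hf
  have h3 : mvfderiv 𝓘(ℝ, F) ((fun z ↦ f ((κ p₀).symm z)) ∘ κ p₀) p v
      = mfderiv 𝓘(ℝ, F) 𝓘(ℝ, G) (fun z ↦ f ((κ p₀).symm z)) (κ p₀ p)
        (mfderiv 𝓘(ℝ, F) 𝓘(ℝ, F) (κ p₀) p v) :=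
    mfderiv_comp_apply p h2.mdifferentiableAt
      ((contMDiffAt_chart hp).mdifferentiableAt (by simp)) v
  have h4 : mvfderiv 𝓘(ℝ, F) f p v
      = mvfderiv 𝓘(ℝ, F) ((fun z ↦ f ((κ p₀).symm z)) ∘ κ p₀) p v :=
    DFunLike.congr_fun h1.mfderiv_eq v
  rw [h4, h3, coord_eq_mfderiv hp]
  exact DFunLike.congr_fun mfderiv_eq_fderiv _

/-- The component function of a vector field in the chart around `p₀`. -/
noncomputable def hat (p₀ : M) (Y : Π p : M, TangentSpace 𝓘(ℝ, F) p) (z : F) : F :=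
  coord F p₀ ((κ p₀).symm z) (Y ((κ p₀).symm z))

/-- The vector field with constant components in the chart around `p₀`. -/
noncomputable def constField (p₀ : M) (a : F) (p : M) : TangentSpace 𝓘(ℝ, F) p := ofCoord p₀ p a

theorem hat_apply_chart {p₀ p : M} (hp : p ∈ (κ p₀).source)
    (Y : Π p : M, TangentSpace 𝓘(ℝ, F) p) : hat p₀ Y (κ p₀ p) = coord F p₀ p (Y p) := by
  rw [hat, (κ p₀).left_inv hp]

theorem hat_constField {p₀ : M} {z : F} (hz : z ∈ (κ p₀).target) (a : F) :
    hat p₀ (constField p₀ a) z = a :=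
  coord_ofCoord ((κ p₀).map_target hz) a

theorem hat_constField_eventuallyEq {p₀ : M} {z : F} (hz : z ∈ (κ p₀).target) (a : F) :
    hat p₀ (constField p₀ a) =ᶠ[nhds z] fun _ ↦ a := by
  filter_upwards [chart_target_mem_nhds hz] with w hw using hat_constField hw a

theorem mdifferentiableAt_vectorField_iff {p₀ p : M} (hp : p ∈ (κ p₀).source)
    {Y : Π p : M, TangentSpace 𝓘(ℝ, F) p} :
    MDiffAt (T% Y) p ↔ DifferentiableAt ℝ (hat p₀ Y) (κ p₀ p) := by
  rw [Trivialization.mdifferentiableAt_totalSpace_iff 𝓘(ℝ, F)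
    (trivializationAt F (TangentSpace 𝓘(ℝ, F)) p₀) _
    ((trivializationAt F (TangentSpace 𝓘(ℝ, F)) p₀).mem_source.2 (mem_baseSet hp)),
    mdifferentiableAt_iff_chart hp]
  have h1 : (fun z ↦ (trivializationAt F (TangentSpace 𝓘(ℝ, F)) p₀
      ⟨(κ p₀).symm z, Y ((κ p₀).symm z)⟩).2) =ᶠ[nhds (κ p₀ p)] hat p₀ Y := by
    filter_upwards [chart_target_mem_nhds ((κ p₀).map_source hp)] with z hz
    rw [hat, coord_eq_snd ((κ p₀).map_target hz)]
  rw [h1.differentiableAt_iff]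
  exact and_iff_right mdifferentiableAt_id

theorem mdifferentiableAt_constField {p₀ p : M} (hp : p ∈ (κ p₀).source) (a : F) :
    MDiffAt (T% (constField p₀ a)) p := by
  rw [mdifferentiableAt_vectorField_iff hp,
    (hat_constField_eventuallyEq ((κ p₀).map_source hp) a).differentiableAt_iff]
  exact differentiableAt_const a

theorem contMDiffAt_vectorField_of_hat {p₀ p : M} (hp : p ∈ (κ p₀).source)
    {Y : Π p : M, TangentSpace 𝓘(ℝ, F) p} (hY : ContDiffAt ℝ ∞ (hat p₀ Y) (κ p₀ p)) :
    ContMDiffAt 𝓘(ℝ, F) 𝓘(ℝ, F).tangent ∞ (T% Y) p := by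
  refine ((trivializationAt F (TangentSpace 𝓘(ℝ, F)) p₀).contMDiffAt_section_iff
    (mem_baseSet hp)).2 ?_
  have h1 : ContMDiffAt 𝓘(ℝ, F) 𝓘(ℝ, F) ∞ (fun q ↦ hat p₀ Y (κ p₀ q)) p :=
    ContMDiffAt.comp p (g := hat p₀ Y) hY.contMDiffAt (contMDiffAt_chart hp)
  refine h1.congr_of_eventuallyEq ?_
  filter_upwards [chart_source_mem_nhds hp] with q hq
  rw [hat_apply_chart hq, coord_eq_snd hq]

theorem contMDiffAt_constField {p₀ p : M} (hp : p ∈ (κ p₀).source) (a : F) :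
    ContMDiffAt 𝓘(ℝ, F) 𝓘(ℝ, F).tangent ∞ (T% (constField p₀ a)) p :=
  contMDiffAt_vectorField_of_hat hp
    (contDiffAt_const.congr_of_eventuallyEq
      (hat_constField_eventuallyEq ((κ p₀).map_source hp) a))

theorem contDiffAt_hat {p₀ : M} {z : F} (hz : z ∈ (κ p₀).target)
    {Y : Π p : M, TangentSpace 𝓘(ℝ, F) p}
    (hY : ContMDiffAt 𝓘(ℝ, F) 𝓘(ℝ, F).tangent ∞ (T% Y) ((κ p₀).symm z)) :
    ContDiffAt ℝ ∞ (hat p₀ Y) z := by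
  have hp := (κ p₀).map_target hz
  have h1 := ((trivializationAt F (TangentSpace 𝓘(ℝ, F)) p₀).contMDiffAt_section_iff
    (mem_baseSet hp)).1 hY
  have h2 := (ContMDiffAt.comp z h1 (contMDiffAt_chart_symm hz)).contDiffAt
  refine h2.congr_of_eventuallyEq ?_
  filter_upwards [chart_target_mem_nhds hz] with w hw
  rw [hat, coord_eq_snd ((κ p₀).map_target hw)]
  rfl

/-- The Lie bracket in a chart. -/
theorem coord_mlieBracket {p₀ p : M} (hp : p ∈ (κ p₀).source)
    {X Y : Π p : M, TangentSpace 𝓘(ℝ, F) p} (hX : MDiffAt (T% X) p) (hY : MDiffAt (T% Y) p) :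
    coord F p₀ p (mlieBracket 𝓘(ℝ, F) X Y p)
      = fderiv ℝ (hat p₀ Y) (κ p₀ p) (coord F p₀ p (X p))
        - fderiv ℝ (hat p₀ X) (κ p₀ p) (coord F p₀ p (Y p)) := by
  have hz := (κ p₀).map_source hp
  have hpull (V : Π p : M, TangentSpace 𝓘(ℝ, F) p) {z : F} (hz : z ∈ (κ p₀).target) :
      mpullback 𝓘(ℝ, F) 𝓘(ℝ, F) (κ p₀).symm V z = hat p₀ V z := by
    have hq := (κ p₀).map_target hz
    have h1 := ofCoord_eq_mfderiv hq
    rw [(κ p₀).right_inv hz] at h1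
    have h2 : (mfderiv 𝓘(ℝ, F) 𝓘(ℝ, F) (κ p₀).symm z).inverse = coord F p₀ ((κ p₀).symm z) :=
      ContinuousLinearMap.inverse_eq
        (ContinuousLinearMap.ext fun v ↦
          (DFunLike.congr_fun h1 _).symm.trans (ofCoord_coord hq v))
        (ContinuousLinearMap.ext fun v ↦
          (congrArg (coord F p₀ _) (DFunLike.congr_fun h1 v).symm).trans (coord_ofCoord hq v))
    exact DFunLike.congr_fun h2 _
  have hev (V : Π p : M, TangentSpace 𝓘(ℝ, F) p) :
      mpullback 𝓘(ℝ, F) 𝓘(ℝ, F) (κ p₀).symm V =ᶠ[nhds (κ p₀ p)] hat p₀ V := by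
    filter_upwards [chart_target_mem_nhds hz] with z hz using hpull V hz
  have : IsManifold 𝓘(ℝ, F) (minSmoothness ℝ 2) M :=
    IsManifold.of_le (n := ∞) (by simpa using two_le_infty)
  have : IsManifold 𝓘(ℝ, F) (minSmoothness ℝ 3) M :=
    IsManifold.of_le (n := ∞) (by simp; norm_cast)
  have h1 := mpullback_mlieBracket (I := 𝓘(ℝ, F)) (I' := 𝓘(ℝ, F)) (f := (κ p₀).symm) (V := X)
    (W := Y) (x₀ := κ p₀ p) (n := ∞) (by rwa [(κ p₀).left_inv hp]) (by rwa [(κ p₀).left_inv hp])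
    (contMDiffAt_chart_symm hz) (by simpa using two_le_infty)
  rw [hpull _ hz, hat_apply_chart hp, (hev X).mlieBracket_vectorField_eq (hev Y)] at h1
  rw [h1, ← hat_apply_chart hp X, ← hat_apply_chart hp Y]
  have h2 (V W : Π z : F, TangentSpace 𝓘(ℝ, F) z) (z : F) :
      mlieBracket 𝓘(ℝ, F) V W z = lieBracket ℝ V W z := by
    rw [← mlieBracketWithin_univ, mlieBracketWithin_eq_lieBracketWithin]
    exact congrFun (lieBracketWithin_univ (V := V) (W := W)) z
  exact h2 _ _ _

end Chart

/-! ### The Levi-Civita connection in a chart -/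

section RiemannianChart

set_option maxSynthPendingDepth 3

variable {F : Type*} [NormedAddCommGroup F] [NormedSpace ℝ F] [FiniteDimensional ℝ F]
  {M : Type*} [TopologicalSpace M] [ChartedSpace F M] [IsManifold 𝓘(ℝ, F) ∞ M]
  [RiemannianBundle (fun x : M ↦ TangentSpace 𝓘(ℝ, F) x)]
  [IsContMDiffRiemannianBundle 𝓘(ℝ, F) ∞ F (fun x : M ↦ TangentSpace 𝓘(ℝ, F) x)]

local notation "κ" => extChartAt (modelWithCornersSelf ℝ F)

/-- The coefficients of the Riemannian metric in the chart around `p₀`. -/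
noncomputable def chartMetric (p₀ : M) (y : F) : F →L[ℝ] F →L[ℝ] ℝ :=
  LinearMap.toContinuousLinearMap (LinearMap.toContinuousLinearMap.toLinearMap ∘ₗ
    (innerₗ (TangentSpace 𝓘(ℝ, F) ((κ p₀).symm y))).compl₁₂
      (ofCoord p₀ ((κ p₀).symm y)).toLinearMap (ofCoord p₀ ((κ p₀).symm y)).toLinearMap)

theorem chartMetric_apply (p₀ : M) (y a b : F) :
    chartMetric p₀ y a b
      = inner ℝ (ofCoord p₀ ((κ p₀).symm y) a) (ofCoord p₀ ((κ p₀).symm y) b) := rfl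

theorem inner_eq_chartMetric {p₀ p : M} (hp : p ∈ (κ p₀).source) (v w : TangentSpace 𝓘(ℝ, F) p) :
    (inner ℝ v w : ℝ) = chartMetric p₀ (κ p₀ p) (coord F p₀ p v) (coord F p₀ p w) := by
  rw [chartMetric_apply, (κ p₀).left_inv hp, ofCoord_coord hp, ofCoord_coord hp]

theorem inner_eq_chartMetric_hat {p₀ : M} {z : F} (hz : z ∈ (κ p₀).target)
    (X Y : Π p : M, TangentSpace 𝓘(ℝ, F) p) :
    (inner ℝ (X ((κ p₀).symm z)) (Y ((κ p₀).symm z)) : ℝ)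
      = chartMetric p₀ z (hat p₀ X z) (hat p₀ Y z) := by
  rw [inner_eq_chartMetric ((κ p₀).map_target hz), (κ p₀).right_inv hz]
  rfl

theorem contDiffOn_chartMetric (p₀ : M) : ContDiffOn ℝ ∞ (chartMetric p₀) (κ p₀).target := by
  refine contDiffOn_clm_apply.2 fun a ↦ contDiffOn_clm_apply.2 fun b z hz ↦ ?_
  have hp := (κ p₀).map_target hz
  have h1 : ContMDiffAt 𝓘(ℝ, F) 𝓘(ℝ) ∞
      (fun q ↦ (inner ℝ (constField p₀ a q) (constField p₀ b q) : ℝ)) ((κ p₀).symm z) :=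
    ContMDiffAt.inner_bundle (E := fun x : M ↦ TangentSpace 𝓘(ℝ, F) x) (F := F) (IB := 𝓘(ℝ, F))
      (b := fun q ↦ q) (v := constField p₀ a) (w := constField p₀ b)
      (contMDiffAt_constField hp a) (contMDiffAt_constField hp b)
  exact (ContMDiffAt.comp z h1 (contMDiffAt_chart_symm hz)).contDiffAt.contDiffWithinAt

theorem chartMetric_symm (p₀ : M) (y a b : F) : chartMetric p₀ y a b = chartMetric p₀ y b a := by
  rw [chartMetric_apply, chartMetric_apply, real_inner_comm]

theorem chartMetric_pos {p₀ : M} {y : F} (hy : y ∈ (κ p₀).target) {a : F} (ha : a ≠ 0) :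
    0 < chartMetric p₀ y a a := by
  rw [chartMetric_apply]
  refine real_inner_self_pos.2 fun h ↦ ha ?_
  rw [← coord_ofCoord ((κ p₀).map_target hy) a, h, map_zero]

theorem exists_isChristoffel_chart (p₀ : M) :
    ∃ Γ, IsChristoffel (κ p₀).target (chartMetric p₀) Γ :=
  exists_isChristoffel (isOpen_extChartAt_target p₀) (contDiffOn_chartMetric p₀)
    (fun y _ ↦ chartMetric_symm p₀ y) (fun _ hy _ ha ↦ chartMetric_pos hy ha)

theorem mvfderiv_inner {p₀ p : M} (hp : p ∈ (κ p₀).source)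
    {X Y : Π p : M, TangentSpace 𝓘(ℝ, F) p} (hX : MDiffAt (T% X) p) (hY : MDiffAt (T% Y) p)
    (w : TangentSpace 𝓘(ℝ, F) p) :
    mvfderiv 𝓘(ℝ, F) (fun q ↦ (inner ℝ (X q) (Y q) : ℝ)) p w
      = fderiv ℝ (fun z ↦ chartMetric p₀ z (hat p₀ X z) (hat p₀ Y z)) (κ p₀ p)
          (coord F p₀ p w) := by
  rw [mvfderiv_eq_fderiv_chart hp (mdifferentiableAt_inner hX hY)]
  congr 1
  refine Filter.EventuallyEq.fderiv_eq ?_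
  filter_upwards [chart_target_mem_nhds ((κ p₀).map_source hp)] with z hz
    using inner_eq_chartMetric_hat hz X Y

/-- A Levi-Civita connection satisfies the Koszul formula. -/
theorem IsLeviCivita.two_mul_inner_eq_koszul
    {D : CovariantDerivative 𝓘(ℝ, F) F (fun x : M ↦ TangentSpace 𝓘(ℝ, F) x)} (hD : IsLeviCivita D)
    {p : M} {X Y Z : Π p : M, TangentSpace 𝓘(ℝ, F) p} (hX : MDiffAt (T% X) p)
    (hY : MDiffAt (T% Y) p) (hZ : MDiffAt (T% Z) p) :
    2 * inner ℝ (D Y p (X p)) (Z p) = koszul 𝓘(ℝ, F) X Y Z p := by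
  rw [koszul, hD.metric hX hY hZ, hD.metric hY hX hZ, hD.metric hZ hX hY, ← hD.torsion_free hX hY,
    ← hD.torsion_free hX hZ, ← hD.torsion_free hY hZ]
  simp only [inner_sub_left]
  rw [real_inner_comm (Y p) (D Z p (X p)), real_inner_comm (X p) (D Z p (Y p)),
    real_inner_comm (X p) (D Y p (Z p))]
  ring

variable {p₀ : M} {Γ : F → F →L[ℝ] F →L[ℝ] F}

/-- The components of `∇_w Y` in a chart. -/
theorem coord_leviCivita (hΓ : IsChristoffel (κ p₀).target (chartMetric p₀) Γ) {p : M}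
    (hp : p ∈ (κ p₀).source) {Y : Π p : M, TangentSpace 𝓘(ℝ, F) p} (hY : MDiffAt (T% Y) p)
    (w : TangentSpace 𝓘(ℝ, F) p) :
    coord F p₀ p (leviCivita 𝓘(ℝ, F) M Y p w)
      = covDifferential Γ (hat p₀ Y) (κ p₀ p) (coord F p₀ p w) := by
  have hz := (κ p₀).map_source hp
  refine hΓ.eq_of_metric_eq hz fun c ↦ ?_
  set y := κ p₀ p
  set a := coord F p₀ p w with ha
  have hX : MDiffAt (T% (constField p₀ a)) p := mdifferentiableAt_constField hp a
  have hZ : MDiffAt (T% (constField p₀ c)) p := mdifferentiableAt_constField hp c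
  have hXp : constField p₀ a p = w := ofCoord_coord hp w
  have hcp (b : F) : coord F p₀ p (constField p₀ b p) = b := coord_ofCoord hp b
  have key := isLeviCivita_leviCivita.two_mul_inner_eq_koszul hX hY hZ
  have dY := (mdifferentiableAt_vectorField_iff hp).1 hY
  have dg := hΓ.differentiableAt_metric hz
  have hc (b : F) := hat_constField_eventuallyEq hz b
  have f0 (b : F) : fderiv ℝ (hat p₀ (constField p₀ b)) y = 0 := by
    rw [(hc b).fderiv_eq]; simp
  have e1 : fderiv ℝ (fun z ↦ chartMetric p₀ z (hat p₀ Y z) (hat p₀ (constField p₀ c) z)) y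
      = fderiv ℝ (fun z ↦ chartMetric p₀ z (hat p₀ Y z) c) y := by
    refine Filter.EventuallyEq.fderiv_eq ?_
    filter_upwards [hc c] with z hz
    rw [hz]
  have e2 : fderiv ℝ (fun z ↦ chartMetric p₀ z (hat p₀ (constField p₀ a) z)
        (hat p₀ (constField p₀ c) z)) y = fderiv ℝ (fun z ↦ chartMetric p₀ z a c) y := by
    refine Filter.EventuallyEq.fderiv_eq ?_
    filter_upwards [hc a, hc c] with z hz hz'
    rw [hz, hz']
  have e3 : fderiv ℝ (fun z ↦ chartMetric p₀ z (hat p₀ (constField p₀ a) z) (hat p₀ Y z)) y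
      = fderiv ℝ (fun z ↦ chartMetric p₀ z (hat p₀ Y z) a) y := by
    refine Filter.EventuallyEq.fderiv_eq ?_
    filter_upwards [hc a] with z hz
    rw [hz, chartMetric_symm]
  have e4 (b b' : F) : fderiv ℝ (fun z ↦ chartMetric p₀ z (hat p₀ Y z) b) y b'
      = fderiv ℝ (chartMetric p₀) y b' (coord F p₀ p (Y p)) b
        + chartMetric p₀ y (fderiv ℝ (hat p₀ Y) y b') b := by
    rw [fderiv_clm_apply_const (dg.clm_apply dY), fderiv_clm_apply dg dY, ← hat_apply_chart hp Y]
    simp [add_comm]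
    rfl
  have e5 (b b' b'' : F) : fderiv ℝ (fun z ↦ chartMetric p₀ z b b') y b''
      = fderiv ℝ (chartMetric p₀) y b'' b b' := by
    rw [fderiv_clm_apply_const (dg.clm_apply (differentiableAt_const b)),
      fderiv_clm_apply_const dg]
  rw [koszul, mvfderiv_inner hp hY hZ, mvfderiv_inner hp hX hZ, mvfderiv_inner hp hX hY,
    e1, e2, e3, hXp, inner_eq_chartMetric hp, inner_eq_chartMetric hp, inner_eq_chartMetric hp,
    inner_eq_chartMetric hp, coord_mlieBracket hp hX hY, coord_mlieBracket hp hX hZ,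
    coord_mlieBracket hp hY hZ, f0, f0, hXp, hcp, ← ha, e4, e4, e5] at key
  have hk := hΓ.koszul hz a (coord F p₀ p (Y p)) c
  have hgs (b b' : F) :
      fderiv ℝ (chartMetric p₀) y c b b' = fderiv ℝ (chartMetric p₀) y c b' b := by
    rw [← e5, ← e5]
    simp only [chartMetric_symm p₀ _ b b']
  have hs := chartMetric_symm p₀ y
  rw [covDifferential_apply, hat_apply_chart hp]
  simp only [map_neg, map_zero, map_add, add_apply, zero_apply, neg_apply, zero_sub,
    sub_zero] at key ⊢
  rw [hgs _ a] at key
  linarith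

/-- The components of the curvature tensor in a chart, at its centre. -/
theorem coord_curvatureAt (hΓ : IsChristoffel (κ p₀).target (chartMetric p₀) Γ)
    (x y z : TangentSpace 𝓘(ℝ, F) p₀) :
    coord F p₀ p₀ (curvatureAt p₀ x y z)
      = localCurv Γ (κ p₀ p₀) (coord F p₀ p₀ x) (coord F p₀ p₀ y) (coord F p₀ p₀ z) := by
  have hp := mem_extChartAt_source (I := 𝓘(ℝ, F)) p₀
  have hz := (κ p₀).map_source hp
  have dΓ := hΓ.differentiableAt hz
  have hext (v : TangentSpace 𝓘(ℝ, F) p₀) :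
      ∀ᶠ q in nhds p₀, FiberBundle.extend F v q = ofCoord p₀ q (coord F p₀ p₀ v) := by
    filter_upwards [chart_source_mem_nhds hp] with q hq using extend_eq_ofCoord hq v
  have hhat (v : TangentSpace 𝓘(ℝ, F) p₀) {w : F} (hw : w ∈ (κ p₀).target) :
      hat p₀ (FiberBundle.extend F v) w = coord F p₀ p₀ v := by
    have hq := (κ p₀).map_target hw
    rw [hat, extend_eq_ofCoord hq, coord_ofCoord hq]
  have hhatev (v : TangentSpace 𝓘(ℝ, F) p₀) {w : F} (hw : w ∈ (κ p₀).target) :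
      hat p₀ (FiberBundle.extend F v) =ᶠ[nhds w] fun _ ↦ coord F p₀ p₀ v := by
    filter_upwards [chart_target_mem_nhds hw] with w' hw' using hhat v hw'
  have hmd (v : TangentSpace 𝓘(ℝ, F) p₀) {q : M} (hq : q ∈ (κ p₀).source) :
      MDiffAt (T% (FiberBundle.extend F v)) q := by
    rw [mdifferentiableAt_vectorField_iff hq,
      (hhatev v ((κ p₀).map_source hq)).differentiableAt_iff]
    exact differentiableAt_const _
  have hD (v w : TangentSpace 𝓘(ℝ, F) p₀) : hat p₀ (fun q ↦ leviCivita 𝓘(ℝ, F) M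
      (FiberBundle.extend F w) q (FiberBundle.extend F v q))
        =ᶠ[nhds (κ p₀ p₀)] fun u ↦ Γ u (coord F p₀ p₀ v) (coord F p₀ p₀ w) := by
    filter_upwards [chart_target_mem_nhds hz] with u hu
    have hq := (κ p₀).map_target hu
    rw [hat, coord_leviCivita hΓ hq (hmd w hq), (κ p₀).right_inv hu, covDifferential_apply,
      (hhatev w hu).fderiv_eq, hhat w hu, extend_eq_ofCoord hq v, coord_ofCoord hq]
    simp
  have dD (v w : TangentSpace 𝓘(ℝ, F) p₀) :
      DifferentiableAt ℝ (fun u ↦ Γ u (coord F p₀ p₀ v) (coord F p₀ p₀ w)) (κ p₀ p₀) :=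
    (dΓ.clm_apply (differentiableAt_const _)).clm_apply (differentiableAt_const _)
  have hDD (u v w : TangentSpace 𝓘(ℝ, F) p₀) :
      coord F p₀ p₀ (leviCivita 𝓘(ℝ, F) M (fun q ↦ leviCivita 𝓘(ℝ, F) M
        (FiberBundle.extend F w) q (FiberBundle.extend F v q)) p₀ (FiberBundle.extend F u p₀))
      = fderiv ℝ Γ (κ p₀ p₀) (coord F p₀ p₀ u) (coord F p₀ p₀ v) (coord F p₀ p₀ w)
        + Γ (κ p₀ p₀) (coord F p₀ p₀ u)
          (Γ (κ p₀ p₀) (coord F p₀ p₀ v) (coord F p₀ p₀ w)) := by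
    rw [coord_leviCivita hΓ hp, covDifferential_apply, (hD v w).fderiv_eq, (hD v w).eq_of_nhds,
      fderiv_clm_apply_const (dΓ.clm_apply (differentiableAt_const _)),
      fderiv_clm_apply_const dΓ, FiberBundle.extend_apply_self]
    rw [mdifferentiableAt_vectorField_iff hp, (hD v w).differentiableAt_iff]
    exact dD v w
  have hbr : mlieBracket 𝓘(ℝ, F) (FiberBundle.extend F x) (FiberBundle.extend F y) p₀ = 0 := by
    rw [← ofCoord_coord hp (mlieBracket _ _ _ _), coord_mlieBracket hp (hmd x hp) (hmd y hp),
      (hhatev x hz).fderiv_eq, (hhatev y hz).fderiv_eq]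
    simp
  rw [curvatureAt, curvature, hbr, map_zero, sub_zero, map_sub, hDD, hDD, localCurv]
  abel

/-- The covariant differential of a Killing field is skew. -/
theorem IsKilling.covDifferential_skew (hΓ : IsChristoffel (κ p₀).target (chartMetric p₀) Γ)
    {U : Π p : M, TangentSpace 𝓘(ℝ, F) p} (hU : IsKilling U) {y : F} (hy : y ∈ (κ p₀).target)
    (a b : F) :
    chartMetric p₀ y (covDifferential Γ (hat p₀ U) y a) b
      + chartMetric p₀ y a (covDifferential Γ (hat p₀ U) y b) = 0 := by
  have hp := (κ p₀).map_target hy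
  have hX := contMDiffAt_constField hp a
  have hZ := contMDiffAt_constField hp b
  have hX' := mdifferentiableAt_constField hp a
  have hZ' := mdifferentiableAt_constField hp b
  have hU' : MDiffAt (T% U) ((κ p₀).symm y) := (hU.contMDiff _).mdifferentiableAt (by simp)
  have hc (b : F) := hat_constField_eventuallyEq hy b
  have f0 (b : F) : fderiv ℝ (hat p₀ (constField p₀ b)) y = 0 := by
    rw [(hc b).fderiv_eq]; simp
  have dg := hΓ.differentiableAt_metric hy
  have e2 : fderiv ℝ (fun z ↦ chartMetric p₀ z (hat p₀ (constField p₀ a) z)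
        (hat p₀ (constField p₀ b) z)) y = fderiv ℝ (fun z ↦ chartMetric p₀ z a b) y := by
    refine Filter.EventuallyEq.fderiv_eq ?_
    filter_upwards [hc a, hc b] with z hz hz'
    rw [hz, hz']
  have hcp (b : F) : coord F p₀ ((κ p₀).symm y) (constField p₀ b ((κ p₀).symm y)) = b :=
    coord_ofCoord hp b
  have key := hU.lieDerivative_eq_zero _ _ _ hX hZ
  rw [mvfderiv_inner hp hX' hZ', inner_eq_chartMetric hp, inner_eq_chartMetric hp,
    coord_mlieBracket hp hU' hX', coord_mlieBracket hp hU' hZ', (κ p₀).right_inv hy, e2, f0, f0,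
    hcp, hcp, fderiv_clm_apply_const (dg.clm_apply (differentiableAt_const a)),
    fderiv_clm_apply_const dg, hΓ.compat y hy] at key
  rw [covDifferential_apply, covDifferential_apply]
  have hh : hat p₀ U y = coord F p₀ ((κ p₀).symm y) (U ((κ p₀).symm y)) := rfl
  rw [hh, hΓ.symm y hy a, hΓ.symm y hy b]
  simp only [map_neg, map_add, add_apply, zero_apply, neg_apply, zero_sub] at key ⊢
  linarith

end RiemannianChart

/-! ### Hypersurfaces in a chart -/

section HypersurfaceChart

set_option maxSynthPendingDepth 3

variable {n : ℕ}
  {L : Type*} [TopologicalSpace L] [ChartedSpace (EuclideanSpace ℝ (Fin n)) L]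
  [IsManifold (𝓡 n) ∞ L]
  {M : Type*} [TopologicalSpace M] [ChartedSpace (EuclideanSpace ℝ (Fin (n + 1))) M]
  [IsManifold (𝓡 (n + 1)) ∞ M]
  [RiemannianBundle (fun x : M ↦ TangentSpace (𝓡 (n + 1)) x)]
  [IsContMDiffRiemannianBundle (𝓡 (n + 1)) ∞ (EuclideanSpace ℝ (Fin (n + 1)))
    (fun x : M ↦ TangentSpace (𝓡 (n + 1)) x)]

local notation "𝔼" => EuclideanSpace ℝ (Fin n)
local notation "𝔽" => EuclideanSpace ℝ (Fin (n + 1))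
local notation "χ" => extChartAt (𝓡 n)
local notation "κ" => extChartAt (𝓡 (n + 1))

namespace OrientedHypersurface

variable (S : OrientedHypersurface n L M)

theorem metric_apply (q : L) (v w : TangentSpace (𝓡 n) q) :
    S.metric q v w = inner ℝ (S.diff q v) (S.diff q w) := rfl

theorem metric_symm (q : L) (v w : TangentSpace (𝓡 n) q) : S.metric q v w = S.metric q w v := by
  rw [metric_apply, metric_apply, real_inner_comm]

theorem diff_injective (q : L) : Function.Injective (S.diff q) := S.injective_mfderiv q

theorem metric_pos (q : L) {v : TangentSpace (𝓡 n) q} (hv : v ≠ 0) : 0 < S.metric q v v := by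
  rw [metric_apply]
  exact real_inner_self_pos.2 fun h ↦ hv (S.diff_injective q (by rw [h, map_zero]))

theorem inner_diff_normal (q : L) (v : TangentSpace (𝓡 n) q) :
    (inner ℝ (S.diff q v) (S.normal q) : ℝ) = 0 := S.inner_mfderiv_normal q v

theorem eq_of_metric_eq (q : L) {v w : TangentSpace (𝓡 n) q}
    (h : ∀ u, S.metric q v u = S.metric q w u) : v = w := by
  rw [← sub_eq_zero]
  by_contra hne
  have := S.metric_pos q hne
  rw [map_sub (S.metric q) v w, LinearMap.sub_apply, h, sub_self] at this
  exact lt_irrefl _ this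

theorem metric_tang (q : L) (w : TangentSpace (𝓡 (n + 1)) (S.toFun q)) (v : TangentSpace (𝓡 n) q) :
    S.metric q (S.tang q w) v = inner ℝ w (S.diff q v) :=
  LinearMap.BilinForm.apply_toDual_symm_apply (hB := S.metric_nondegenerate q) _ v

theorem metric_grad (f : L → ℝ) (q : L) (v : TangentSpace (𝓡 n) q) :
    S.metric q (S.grad f q) v = mvfderiv (𝓡 n) f q v :=
  LinearMap.BilinForm.apply_toDual_symm_apply (hB := S.metric_nondegenerate q) _ v

theorem tang_diff (q : L) (v : TangentSpace (𝓡 n) q) : S.tang q (S.diff q v) = v :=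
  S.eq_of_metric_eq q fun u ↦ S.metric_tang q _ u

theorem tang_normal (q : L) : S.tang q (S.normal q) = 0 :=
  S.eq_of_metric_eq q fun u ↦ by
    rw [metric_tang, real_inner_comm, inner_diff_normal, map_zero, LinearMap.zero_apply]

/-- An ambient tangent vector is the sum of its tangential and its normal part. This is where the
codimension enters: the image of the differential and the normal span the tangent space. -/
theorem diff_tang_add (q : L) (w : TangentSpace (𝓡 (n + 1)) (S.toFun q)) :
    S.diff q (S.tang q w) + (inner ℝ w (S.normal q) : ℝ) • S.normal q = w := by
  let T : (TangentSpace (𝓡 n) q × ℝ) →ₗ[ℝ] TangentSpace (𝓡 (n + 1)) (S.toFun q) :=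
    (S.diff q).coprod (LinearMap.toSpanSingleton ℝ _ (S.normal q))
  have hT (v : TangentSpace (𝓡 n) q) (t : ℝ) : T (v, t) = S.diff q v + t • S.normal q := by
    simp [T]
  have hin (v : TangentSpace (𝓡 n) q) (t : ℝ) :
      (inner ℝ (S.diff q v + t • S.normal q) (S.normal q) : ℝ) = t := by
    rw [inner_add_left, real_inner_smul_left, S.inner_normal_self, S.inner_diff_normal]
    ring
  have hinj : Function.Injective T := by
    refine (injective_iff_map_eq_zero T).2 fun ⟨v, t⟩ h ↦ ?_
    rw [hT] at h
    have ht := hin v t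
    rw [h, inner_zero_left] at ht
    rw [← ht, zero_smul, add_zero] at h
    rw [S.diff_injective q (h.trans (map_zero _).symm), ← ht]
    rfl
  have hdim : Module.finrank ℝ (TangentSpace (𝓡 n) q × ℝ)
      = Module.finrank ℝ (TangentSpace (𝓡 (n + 1)) (S.toFun q)) := by
    rw [Module.finrank_prod]
    change Module.finrank ℝ 𝔼 + Module.finrank ℝ ℝ = Module.finrank ℝ 𝔽
    simp
  obtain ⟨⟨v, t⟩, rfl⟩ := (LinearMap.injective_iff_surjective_of_finrank_eq_finrank hdim).1 hinj w
  rw [hT, hin, map_add, tang_diff, map_smul, tang_normal, smul_zero, add_zero]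

/-- The immersion in the charts around `q₀` and its image. -/
noncomputable def locMap (q₀ : L) (x : 𝔼) : 𝔽 := κ (S.toFun q₀) (S.toFun ((χ q₀).symm x))

/-- The components, in the chart around the image of `q₀`, of a field of ambient tangent vectors
along the hypersurface, as a function of the coordinates around `q₀`. -/
noncomputable def locField (q₀ : L) (V : Π q : L, TangentSpace (𝓡 (n + 1)) (S.toFun q)) (x : 𝔼) :
    𝔽 :=
  coord 𝔽 (S.toFun q₀) (S.toFun ((χ q₀).symm x)) (V ((χ q₀).symm x))

/-- The coordinate domain around `q₀`, cut down so that its image lies in the chart of `M`. -/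
def locDom (q₀ : L) : Set 𝔼 :=
  (χ q₀).target ∩ (χ q₀).symm ⁻¹' (S.toFun ⁻¹' (κ (S.toFun q₀)).source)

variable {S} {q₀ : L} {x : EuclideanSpace ℝ (Fin n)}

theorem symm_mem_source (hx : x ∈ S.locDom q₀) : (χ q₀).symm x ∈ (χ q₀).source :=
  (χ q₀).map_target hx.1

theorem image_mem_source (hx : x ∈ S.locDom q₀) :
    S.toFun ((χ q₀).symm x) ∈ (κ (S.toFun q₀)).source := hx.2

theorem locMap_mem (hx : x ∈ S.locDom q₀) : S.locMap q₀ x ∈ (κ (S.toFun q₀)).target :=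
  (κ (S.toFun q₀)).map_source hx.2

theorem symm_locMap (hx : x ∈ S.locDom q₀) :
    (κ (S.toFun q₀)).symm (S.locMap q₀ x) = S.toFun ((χ q₀).symm x) :=
  (κ (S.toFun q₀)).left_inv hx.2

variable (S) in
theorem isOpen_locDom (q₀ : L) : IsOpen (S.locDom q₀) :=
  (continuousOn_extChartAt_symm (I := 𝓡 n) q₀).isOpen_inter_preimage (isOpen_extChartAt_target q₀)
    ((isOpen_extChartAt_source (S.toFun q₀)).preimage S.contMDiff.continuous)

variable (S) in
theorem chart_mem_locDom (q₀ : L) : χ q₀ q₀ ∈ S.locDom q₀ :=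
  ⟨mem_extChartAt_target q₀, by
    rw [Set.mem_preimage, (χ q₀).left_inv (mem_extChartAt_source q₀)]
    exact mem_extChartAt_source (S.toFun q₀)⟩

theorem locDom_mem_nhds (hx : x ∈ S.locDom q₀) : S.locDom q₀ ∈ nhds x :=
  (S.isOpen_locDom q₀).mem_nhds hx

theorem contDiffAt_locMap (hx : x ∈ S.locDom q₀) : ContDiffAt ℝ ∞ (S.locMap q₀) x := by
  have h1 := ContMDiffAt.comp x (S.contMDiff _) (contMDiffAt_chart_symm hx.1)
  exact (ContMDiffAt.comp x (contMDiffAt_chart hx.2) h1).contDiffAt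

theorem contDiffAt_locField {V : Π q : L, TangentSpace (𝓡 (n + 1)) (S.toFun q)}
    (hx : x ∈ S.locDom q₀)
    (hV : ContMDiffAt (𝓡 n) (𝓡 (n + 1)).tangent ∞
      (fun q ↦ (⟨S.toFun q, V q⟩ : TangentBundle (𝓡 (n + 1)) M)) ((χ q₀).symm x)) :
    ContDiffAt ℝ ∞ (S.locField q₀ V) x := by
  have h1 := ((trivializationAt 𝔽 (TangentSpace (𝓡 (n + 1))) (S.toFun q₀)).contMDiffAt_iff
    (x₀ := (χ q₀).symm x)
    ((Trivialization.mem_source _).2 (mem_baseSet (image_mem_source hx)))).1 hV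
  have h2 := (ContMDiffAt.comp x h1.2 (contMDiffAt_chart_symm hx.1)).contDiffAt
  refine h2.congr_of_eventuallyEq ?_
  filter_upwards [locDom_mem_nhds hx] with w hw
  rw [locField, coord_eq_snd hw.2]
  rfl

theorem fderiv_locMap (hx : x ∈ S.locDom q₀) (v : TangentSpace (𝓡 n) ((χ q₀).symm x)) :
    fderiv ℝ (S.locMap q₀) x (coord 𝔼 q₀ ((χ q₀).symm x) v)
      = coord 𝔽 (S.toFun q₀) (S.toFun ((χ q₀).symm x)) (S.diff ((χ q₀).symm x) v) := by
  have hS : MDifferentiableAt (𝓡 n) (𝓡 (n + 1)) S.toFun ((χ q₀).symm x) :=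
    (S.contMDiff _).mdifferentiableAt (by simp)
  have hκ := (contMDiffAt_chart hx.2).mdifferentiableAt (by simp)
  have h1 := mvfderiv_eq_fderiv_chart (symm_mem_source hx)
    (f := fun q ↦ κ (S.toFun q₀) (S.toFun q)) (MDifferentiableAt.comp _ hκ hS) v
  rw [(χ q₀).right_inv hx.1] at h1
  have h2 := mfderiv_comp_apply ((χ q₀).symm x) hκ hS v
  rw [coord_eq_mfderiv hx.2]
  exact h1.symm.trans h2

theorem fderiv_locMap_apply (hx : x ∈ S.locDom q₀) (v : 𝔼) :
    fderiv ℝ (S.locMap q₀) x v = coord 𝔽 (S.toFun q₀) (S.toFun ((χ q₀).symm x))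
      (S.diff ((χ q₀).symm x) (ofCoord q₀ ((χ q₀).symm x) v)) := by
  rw [← fderiv_locMap hx, coord_ofCoord (symm_mem_source hx)]

theorem inner_eq_locMap (hx : x ∈ S.locDom q₀)
    (v w : TangentSpace (𝓡 (n + 1)) (S.toFun ((χ q₀).symm x))) :
    (inner ℝ v w : ℝ) = chartMetric (S.toFun q₀) (S.locMap q₀ x)
      (coord 𝔽 (S.toFun q₀) _ v) (coord 𝔽 (S.toFun q₀) _ w) :=
  inner_eq_chartMetric hx.2 v w

/-- The covariant derivative along the hypersurface, in a chart. Its definition at `q` uses the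
chart around the image of `q`; the transition to the fixed chart around the image of `q₀` adds to
the two terms of the definition contributions that cancel. -/
theorem coord_covAlong {Γ : 𝔽 → 𝔽 →L[ℝ] 𝔽 →L[ℝ] 𝔽}
    (hΓ : IsChristoffel (κ (S.toFun q₀)).target (chartMetric (S.toFun q₀)) Γ)
    {V : Π q : L, TangentSpace (𝓡 (n + 1)) (S.toFun q)} (hx : x ∈ S.locDom q₀)
    (hV : MDifferentiableAt (𝓡 n) (𝓡 (n + 1)).tangent
      (fun q ↦ (⟨S.toFun q, V q⟩ : TangentBundle (𝓡 (n + 1)) M)) ((χ q₀).symm x))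
    (v : TangentSpace (𝓡 n) ((χ q₀).symm x)) :
    coord 𝔽 (S.toFun q₀) _ (S.covAlong V ((χ q₀).symm x) v)
      = covDeriv Γ (S.locMap q₀) (S.locField q₀ V) x (coord 𝔼 q₀ _ v) := by
  have hqs := symm_mem_source hx
  have hps := image_mem_source hx
  have hχq : χ q₀ ((χ q₀).symm x) = x := (χ q₀).right_inv hx.1
  have hψ := fderiv_locMap hx v
  have hψx : S.locMap q₀ x = κ (S.toFun q₀) (S.toFun ((χ q₀).symm x)) := rfl
  have hψs := symm_locMap hx
  have hcont : ContinuousAt (fun z ↦ S.toFun ((χ q₀).symm z)) x :=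
    ContinuousAt.comp S.contMDiff.continuous.continuousAt
      (contMDiffAt_chart_symm hx.1).continuousAt
  have hcont' := hcont.preimage_mem_nhds
    (chart_source_mem_nhds (mem_extChartAt_source (I := 𝓡 (n + 1)) (S.toFun ((χ q₀).symm x))))
  -- the chart around the image of `q` is easier to handle when `q` is a variable
  generalize (χ q₀).symm x = q at *
  have hpp := mem_extChartAt_source (I := 𝓡 (n + 1)) (S.toFun q)
  -- the change of components from the chart around `S.toFun q` to the chart around `S.toFun q₀`
  let C : 𝔽 → 𝔽 →L[ℝ] 𝔽 := fun z ↦ coord 𝔽 (S.toFun q₀) ((κ (S.toFun q₀)).symm z) ∘L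
    ofCoord (S.toFun q) ((κ (S.toFun q₀)).symm z)
  let W := (κ (S.toFun q₀)).target ∩ (κ (S.toFun q₀)).symm ⁻¹' (κ (S.toFun q)).source
  have hW : W ∈ nhds (S.locMap q₀ x) := by
    refine IsOpen.mem_nhds ?_ ⟨locMap_mem hx, by rw [Set.mem_preimage, hψs]; exact hpp⟩
    exact (continuousOn_extChartAt_symm (S.toFun q₀)).isOpen_inter_preimage
      (isOpen_extChartAt_target (S.toFun q₀)) (isOpen_extChartAt_source (S.toFun q))
  have dC : DifferentiableAt ℝ C (S.locMap q₀ x) := by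
    have : ContDiffOn ℝ ∞ C W := contDiffOn_clm_apply.2 fun a z hz ↦
      (contDiffAt_hat (Y := constField (S.toFun q) a) hz.1
        (contMDiffAt_constField hz.2 a)).contDiffWithinAt
    exact (this.contDiffAt hW).differentiableAt (by simp)
  let w : L → 𝔽 := fun q' ↦ (trivializationAt 𝔽 (fun x : M ↦ TangentSpace (𝓡 (n + 1)) x)
    (S.toFun q) ⟨S.toFun q', V q'⟩).2
  have dw : MDifferentiableAt (𝓡 n) 𝓘(ℝ, 𝔽) w q := ((mdifferentiableAt_totalSpace _ _).1 hV).2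
  have dw' : DifferentiableAt ℝ (fun z ↦ w ((χ q₀).symm z)) x := by
    rw [← hχq]
    exact (mdifferentiableAt_iff_chart hqs).1 dw
  have hdw : mvfderiv (𝓡 n) w q v
      = fderiv ℝ (fun z ↦ w ((χ q₀).symm z)) x (coord 𝔼 q₀ q v) := by
    rw [mvfderiv_eq_fderiv_chart hqs dw, hχq]
  have hwx : w ((χ q₀).symm x) = w q := by rw [← hχq, (χ q₀).left_inv hqs]
  have hw0 : w q = coord 𝔽 (S.toFun q) (S.toFun q) (V q) := (coord_eq_snd hpp (V q)).symm
  have dψ : DifferentiableAt ℝ (S.locMap q₀) x :=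
    (contDiffAt_locMap hx).differentiableAt (by simp)
  have hV1 : S.locField q₀ V =ᶠ[nhds x] fun z ↦ C (S.locMap q₀ z) (w ((χ q₀).symm z)) := by
    filter_upwards [locDom_mem_nhds hx, hcont'] with z hz hz'
    have e1 : w ((χ q₀).symm z) = coord 𝔽 (S.toFun q) _ (V ((χ q₀).symm z)) :=
      (coord_eq_snd hz' _).symm
    change _ = coord 𝔽 (S.toFun q₀) ((κ (S.toFun q₀)).symm (S.locMap q₀ z))
      (ofCoord (S.toFun q) _ _)
    rw [e1, symm_locMap hz, ofCoord_coord hz']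
    rfl
  have hext : hat (S.toFun q₀) (FiberBundle.extend 𝔽 (V q)) =ᶠ[nhds (S.locMap q₀ x)]
      fun z ↦ C z (w q) := by
    filter_upwards [hW] with z hz
    rw [hat, extend_eq_ofCoord hz.2, hw0]
    rfl
  have hextd : MDifferentiableAt (𝓡 (n + 1)) (𝓡 (n + 1)).tangent
      (fun p ↦ (⟨p, FiberBundle.extend 𝔽 (V q) p⟩ : TangentBundle (𝓡 (n + 1)) M)) (S.toFun q) :=
    FiberBundle.mdifferentiableAt_extend ..
  have hC (a : 𝔽) : C (S.locMap q₀ x) a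
      = coord 𝔽 (S.toFun q₀) (S.toFun q) (ofCoord (S.toFun q) (S.toFun q) a) := by
    change coord 𝔽 (S.toFun q₀) ((κ (S.toFun q₀)).symm (S.locMap q₀ x))
      (ofCoord (S.toFun q) ((κ (S.toFun q₀)).symm (S.locMap q₀ x)) a) = _
    rw [hψs]
  have hval : C (S.locMap q₀ x) (w q) = S.locField q₀ V x := by
    rw [hV1.eq_of_nhds, hwx]
  have dCψ : DifferentiableAt ℝ (fun z ↦ C (S.locMap q₀ z)) x :=
    DifferentiableAt.comp (g := C) x dC dψ
  have hcomp : fderiv ℝ (fun z ↦ C (S.locMap q₀ z)) x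
      = fderiv ℝ C (S.locMap q₀ x) ∘L fderiv ℝ (S.locMap q₀) x := fderiv_comp (g := C) x dC dψ
  have hcov : S.covAlong V q v = ofCoord (S.toFun q) (S.toFun q) (mvfderiv (𝓡 n) w q v)
      + leviCivita (𝓡 (n + 1)) M (FiberBundle.extend 𝔽 (V q)) (S.toFun q) (S.diff q v) := rfl
  rw [hcov, map_add, ← hC, hdw, coord_leviCivita hΓ hps hextd, ← hψx, covDifferential_apply,
    hext.fderiv_eq, hext.eq_of_nhds, fderiv_clm_apply_const dC, ← hψ, hval, covDeriv,
    hV1.fderiv_eq, fderiv_clm_apply dCψ dw', hcomp, hwx]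
  exact (add_assoc _ _ _).symm

end OrientedHypersurface

end HypersurfaceChart

/-! ### The shape operator and the mean curvatures in a chart -/

section ShapeChart

set_option maxSynthPendingDepth 3

variable {n : ℕ}
  {L : Type*} [TopologicalSpace L] [ChartedSpace (EuclideanSpace ℝ (Fin n)) L]
  [IsManifold (𝓡 n) ∞ L]
  {M : Type*} [TopologicalSpace M] [ChartedSpace (EuclideanSpace ℝ (Fin (n + 1))) M]
  [IsManifold (𝓡 (n + 1)) ∞ M]
  [RiemannianBundle (fun x : M ↦ TangentSpace (𝓡 (n + 1)) x)]
  [IsContMDiffRiemannianBundle (𝓡 (n + 1)) ∞ (EuclideanSpace ℝ (Fin (n + 1)))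
    (fun x : M ↦ TangentSpace (𝓡 (n + 1)) x)]

local notation "𝔼" => EuclideanSpace ℝ (Fin n)
local notation "𝔽" => EuclideanSpace ℝ (Fin (n + 1))
local notation "χ" => extChartAt (𝓡 n)
local notation "κ" => extChartAt (𝓡 (n + 1))

variable (n) in
/-- The trace of a continuous endomorphism, as a continuous linear form. -/
noncomputable def traceCLM : (𝔼 →L[ℝ] 𝔼) →L[ℝ] ℝ :=
  LinearMap.toContinuousLinearMap (LinearMap.trace ℝ 𝔼 ∘ₗ ContinuousLinearMap.coeLM ℝ)

theorem traceCLM_apply (a : 𝔼 →L[ℝ] 𝔼) : traceCLM n a = LinearMap.trace ℝ 𝔼 a.toLinearMap := rfl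

theorem traceCLM_mul_comm (a b : 𝔼 →L[ℝ] 𝔼) : traceCLM n (a * b) = traceCLM n (b * a) :=
  LinearMap.trace_mul_comm ℝ a.toLinearMap b.toLinearMap

/-- Endomorphisms of the model space act on the tangent space at `q` through the chart
around `q₀`. -/
noncomputable def chartConj {q₀ q : L} (hq : q ∈ (χ q₀).source) :
    (𝔼 →L[ℝ] 𝔼) →ₐ[ℝ] Module.End ℝ (TangentSpace (𝓡 n) q) :=
  AlgHom.ofLinearMap
    { toFun := fun a ↦ (ofCoord q₀ q).toLinearMap ∘ₗ a.toLinearMap ∘ₗ (coord 𝔼 q₀ q).toLinearMap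
      map_add' := fun a b ↦ LinearMap.ext fun v ↦ map_add (ofCoord q₀ q) _ _
      map_smul' := fun c a ↦ LinearMap.ext fun v ↦ (ofCoord q₀ q).map_smul c (a (coord 𝔼 q₀ q v)) }
    (LinearMap.ext fun v ↦ ofCoord_coord hq v)
    (fun a b ↦ LinearMap.ext fun v ↦ by
      change ofCoord q₀ q (a (b _)) = ofCoord q₀ q (a (coord 𝔼 q₀ q (ofCoord q₀ q (b _))))
      rw [coord_ofCoord hq])

theorem chartConj_apply {q₀ q : L} (hq : q ∈ (χ q₀).source) (a : 𝔼 →L[ℝ] 𝔼)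
    (v : TangentSpace (𝓡 n) q) :
    chartConj hq a v = ofCoord q₀ q (a (coord 𝔼 q₀ q v)) := rfl

theorem trace_chartConj {q₀ q : L} (hq : q ∈ (χ q₀).source) (a : 𝔼 →L[ℝ] 𝔼) :
    LinearMap.trace ℝ (TangentSpace (𝓡 n) q) (chartConj hq a) = traceCLM n a := by
  change LinearMap.trace ℝ (TangentSpace (𝓡 n) q) ((ofCoord q₀ q).toLinearMap ∘ₗ
    (a.toLinearMap ∘ₗ (coord 𝔼 q₀ q).toLinearMap)) = _
  rw [LinearMap.trace_comp_comm', traceCLM_apply]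
  congr 1
  ext1 v
  exact congrArg a (coord_ofCoord hq v)

namespace OrientedHypersurface

variable (S : OrientedHypersurface n L M)

/-- The shape operator in the chart around `q₀`. -/
noncomputable def locShape (q₀ : L) (x : 𝔼) : 𝔼 →L[ℝ] 𝔼 :=
  LinearMap.toContinuousLinearMap ((coord 𝔼 q₀ ((χ q₀).symm x)).toLinearMap ∘ₗ
    S.shape ((χ q₀).symm x) ∘ₗ (ofCoord q₀ ((χ q₀).symm x)).toLinearMap)

/-- The components of the tangential part of a field along the hypersurface, in the chart
around `q₀`. -/
noncomputable def locTang (q₀ : L) (V : Π q : L, TangentSpace (𝓡 (n + 1)) (S.toFun q)) (x : 𝔼) :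
    𝔼 :=
  coord 𝔼 q₀ ((χ q₀).symm x) (S.tang ((χ q₀).symm x) (V ((χ q₀).symm x)))

/-- The coefficients of the induced metric in the chart around `q₀`. -/
noncomputable def locMetric (q₀ : L) (x : 𝔼) : 𝔼 →L[ℝ] 𝔼 →L[ℝ] ℝ :=
  (chartMetric (S.toFun q₀) (S.locMap q₀ x)).bilinearComp (fderiv ℝ (S.locMap q₀) x)
    (fderiv ℝ (S.locMap q₀) x)

variable {S} {q₀ : L} {x : EuclideanSpace ℝ (Fin n)}

theorem locShape_apply (x a : 𝔼) :
    S.locShape q₀ x a = coord 𝔼 q₀ ((χ q₀).symm x)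
      (S.shape ((χ q₀).symm x) (ofCoord q₀ ((χ q₀).symm x) a)) := rfl

theorem locMetric_apply (x a b : 𝔼) :
    S.locMetric q₀ x a b = chartMetric (S.toFun q₀) (S.locMap q₀ x)
      (fderiv ℝ (S.locMap q₀) x a) (fderiv ℝ (S.locMap q₀) x b) := rfl

theorem coord_shape (hx : x ∈ S.locDom q₀) (v : TangentSpace (𝓡 n) ((χ q₀).symm x)) :
    coord 𝔼 q₀ _ (S.shape ((χ q₀).symm x) v) = S.locShape q₀ x (coord 𝔼 q₀ _ v) := by
  rw [locShape_apply, ofCoord_coord (symm_mem_source hx)]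

theorem chartConj_locShape (hx : x ∈ S.locDom q₀) :
    chartConj (symm_mem_source hx) (S.locShape q₀ x) = S.shape ((χ q₀).symm x) := by
  ext1 v
  rw [chartConj_apply, ← coord_shape hx, ofCoord_coord (symm_mem_source hx)]

theorem metric_eq_locMetric (hx : x ∈ S.locDom q₀) (v w : TangentSpace (𝓡 n) ((χ q₀).symm x)) :
    S.metric _ v w = S.locMetric q₀ x (coord 𝔼 q₀ _ v) (coord 𝔼 q₀ _ w) := by
  rw [metric_apply, inner_eq_locMap hx, locMetric_apply, fderiv_locMap hx, fderiv_locMap hx]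

theorem locMetric_pos (hx : x ∈ S.locDom q₀) {a : 𝔼} (ha : a ≠ 0) :
    0 < S.locMetric q₀ x a a := by
  have hq := symm_mem_source hx
  rw [← coord_ofCoord hq a, ← metric_eq_locMetric hx]
  refine S.metric_pos _ fun h ↦ ha ?_
  rw [← coord_ofCoord hq a, h, map_zero]

theorem contDiffOn_locMap : ContDiffOn ℝ ∞ (S.locMap q₀) (S.locDom q₀) := fun _ hx ↦
  (contDiffAt_locMap hx).contDiffWithinAt

theorem contDiffOn_fderiv_locMap : ContDiffOn ℝ ∞ (fderiv ℝ (S.locMap q₀)) (S.locDom q₀) :=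
  contDiffOn_locMap.fderiv_of_isOpen (S.isOpen_locDom q₀) (by simp)

theorem contDiffOn_chartMetric_locMap :
    ContDiffOn ℝ ∞ (fun x ↦ chartMetric (S.toFun q₀) (S.locMap q₀ x)) (S.locDom q₀) :=
  (contDiffOn_chartMetric (S.toFun q₀)).comp contDiffOn_locMap fun _ hx ↦ locMap_mem hx

theorem contDiffOn_locMetric : ContDiffOn ℝ ∞ (S.locMetric q₀) (S.locDom q₀) :=
  contDiffOn_clm_apply.2 fun _ ↦ contDiffOn_clm_apply.2 fun _ ↦
    (contDiffOn_chartMetric_locMap.clm_apply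
      (contDiffOn_fderiv_locMap.clm_apply contDiffOn_const)).clm_apply
      (contDiffOn_fderiv_locMap.clm_apply contDiffOn_const)

theorem contDiffOn_locField {V : Π q : L, TangentSpace (𝓡 (n + 1)) (S.toFun q)}
    (hV : ContMDiff (𝓡 n) (𝓡 (n + 1)).tangent ∞
      (fun q ↦ (⟨S.toFun q, V q⟩ : TangentBundle (𝓡 (n + 1)) M))) :
    ContDiffOn ℝ ∞ (S.locField q₀ V) (S.locDom q₀) := fun _ hx ↦
  (contDiffAt_locField hx (hV _)).contDiffWithinAt

/-- The tangential part of a smooth field is smooth. -/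
theorem contDiffOn_locTang {V : Π q : L, TangentSpace (𝓡 (n + 1)) (S.toFun q)}
    (hV : ContMDiff (𝓡 n) (𝓡 (n + 1)).tangent ∞
      (fun q ↦ (⟨S.toFun q, V q⟩ : TangentBundle (𝓡 (n + 1)) M))) :
    ContDiffOn ℝ ∞ (S.locTang q₀ V) (S.locDom q₀) := by
  refine contDiffOn_of_represents contDiffOn_locMetric
    ((contDiffOn_chartMetric_locMap.clm_apply (contDiffOn_locField hV)).clm_comp
      contDiffOn_fderiv_locMap) (fun x hx v hv ↦ locMetric_pos hx hv) fun x hx w ↦ ?_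
  rw [← coord_ofCoord (symm_mem_source hx) w, locTang, ← metric_eq_locMetric hx, metric_tang,
    inner_eq_locMap hx, ← fderiv_locMap hx]
  rfl

variable {Γ : EuclideanSpace ℝ (Fin (n + 1)) →
  EuclideanSpace ℝ (Fin (n + 1)) →L[ℝ] EuclideanSpace ℝ (Fin (n + 1)) →L[ℝ]
    EuclideanSpace ℝ (Fin (n + 1))}

theorem differentiableAt_locNormal (hx : x ∈ S.locDom q₀) :
    DifferentiableAt ℝ (S.locField q₀ S.normal) x :=
  (contDiffAt_locField hx (S.contMDiff_normal _)).differentiableAt (by simp)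

theorem coord_covAlong_normal (hΓ : IsChristoffel (κ (S.toFun q₀)).target
      (chartMetric (S.toFun q₀)) Γ) (hx : x ∈ S.locDom q₀)
    (v : TangentSpace (𝓡 n) ((χ q₀).symm x)) :
    coord 𝔽 (S.toFun q₀) _ (S.covAlong S.normal ((χ q₀).symm x) v)
      = covDeriv Γ (S.locMap q₀) (S.locField q₀ S.normal) x (coord 𝔼 q₀ _ v) :=
  coord_covAlong hΓ hx ((S.contMDiff_normal _).mdifferentiableAt (by simp)) v

theorem chartMetric_locNormal (hx : x ∈ S.locDom q₀) :
    chartMetric (S.toFun q₀) (S.locMap q₀ x) (S.locField q₀ S.normal x)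
      (S.locField q₀ S.normal x) = 1 := by
  rw [locField, ← inner_eq_locMap hx, S.inner_normal_self]

theorem chartMetric_fderiv_locNormal (hx : x ∈ S.locDom q₀) (a : 𝔼) :
    chartMetric (S.toFun q₀) (S.locMap q₀ x) (fderiv ℝ (S.locMap q₀) x a)
      (S.locField q₀ S.normal x) = 0 := by
  rw [fderiv_locMap_apply hx, locField, ← inner_eq_locMap hx, S.inner_diff_normal]

/-- The normal is of constant length, hence its derivative is tangential. -/
theorem inner_covAlong_normal (hΓ : IsChristoffel (κ (S.toFun q₀)).target
      (chartMetric (S.toFun q₀)) Γ) (hx : x ∈ S.locDom q₀)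
    (v : TangentSpace (𝓡 n) ((χ q₀).symm x)) :
    (inner ℝ (S.covAlong S.normal ((χ q₀).symm x) v) (S.normal ((χ q₀).symm x)) : ℝ) = 0 := by
  have dψ := (contDiffAt_locMap hx).differentiableAt (by simp)
  have dν := differentiableAt_locNormal hx
  have h1 := hΓ.fderiv_metric (locMap_mem hx) dψ dν dν (coord 𝔼 q₀ _ v)
  have h2 : (fun z ↦ chartMetric (S.toFun q₀) (S.locMap q₀ z) (S.locField q₀ S.normal z)
      (S.locField q₀ S.normal z)) =ᶠ[nhds x] fun _ ↦ 1 := by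
    filter_upwards [locDom_mem_nhds hx] with z hz using chartMetric_locNormal hz
  rw [h2.fderiv_eq, chartMetric_symm _ _ (S.locField q₀ S.normal x)] at h1
  rw [inner_eq_locMap hx, coord_covAlong_normal hΓ hx]
  simp only [fderiv_fun_const, Pi.zero_apply, zero_apply] at h1
  change chartMetric _ _ _ (S.locField q₀ S.normal x) = 0
  linarith

/-- The Weingarten equation. -/
theorem covDeriv_locNormal (hΓ : IsChristoffel (κ (S.toFun q₀)).target
      (chartMetric (S.toFun q₀)) Γ) (hx : x ∈ S.locDom q₀) (a : 𝔼) :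
    covDeriv Γ (S.locMap q₀) (S.locField q₀ S.normal) x a
      = -fderiv ℝ (S.locMap q₀) x (S.locShape q₀ x a) := by
  have hq := symm_mem_source hx
  have h := S.diff_tang_add _ (S.covAlong S.normal _ (ofCoord q₀ ((χ q₀).symm x) a))
  rw [inner_covAlong_normal hΓ hx, zero_smul, add_zero] at h
  have h' : S.diff _ (S.shape _ (ofCoord q₀ ((χ q₀).symm x) a))
      = -S.covAlong S.normal _ (ofCoord q₀ ((χ q₀).symm x) a) := by
    rw [← h, ← map_neg]
    rfl
  rw [locShape_apply, fderiv_locMap hx, h', map_neg, neg_neg, coord_covAlong_normal hΓ hx,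
    coord_ofCoord hq]

/-- The shape operator is self-adjoint, since the second fundamental form
`⟨A v, w⟩ = ⟨N, ∇_v ∂_w⟩` is symmetric. -/
theorem locMetric_locShape_symm (hΓ : IsChristoffel (κ (S.toFun q₀)).target
      (chartMetric (S.toFun q₀)) Γ) (hx : x ∈ S.locDom q₀) (a b : 𝔼) :
    S.locMetric q₀ x (S.locShape q₀ x a) b = S.locMetric q₀ x a (S.locShape q₀ x b) := by
  have cψ := contDiffAt_locMap hx
  have dψ := cψ.differentiableAt (by simp)
  have dν := differentiableAt_locNormal hx
  have dψ' : DifferentiableAt ℝ (fderiv ℝ (S.locMap q₀)) x :=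
    (contDiffOn_fderiv_locMap.contDiffAt (locDom_mem_nhds hx)).differentiableAt (by simp)
  have key (a b : 𝔼) : S.locMetric q₀ x b (S.locShape q₀ x a)
      = chartMetric (S.toFun q₀) (S.locMap q₀ x)
        (covDeriv Γ (S.locMap q₀) (fun z ↦ fderiv ℝ (S.locMap q₀) z b) x a)
        (S.locField q₀ S.normal x) := by
    have h1 := hΓ.fderiv_metric (locMap_mem hx) dψ (dψ'.clm_apply (differentiableAt_const b)) dν a
    have h2 : (fun z ↦ chartMetric (S.toFun q₀) (S.locMap q₀ z) (fderiv ℝ (S.locMap q₀) z b)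
        (S.locField q₀ S.normal z)) =ᶠ[nhds x] fun _ ↦ 0 := by
      filter_upwards [locDom_mem_nhds hx] with z hz using chartMetric_fderiv_locNormal hz b
    rw [h2.fderiv_eq, covDeriv_locNormal hΓ hx, map_neg] at h1
    simp only [fderiv_fun_const, Pi.zero_apply, zero_apply] at h1
    rw [locMetric_apply]
    linarith
  rw [key b a, covDeriv_fderiv_comm (cψ.of_le two_le_infty) (hΓ.symm _ (locMap_mem hx)),
    ← key a b, locMetric_apply, locMetric_apply, chartMetric_symm]

theorem contDiffOn_locShape (hΓ : IsChristoffel (κ (S.toFun q₀)).target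
      (chartMetric (S.toFun q₀)) Γ) : ContDiffOn ℝ ∞ (S.locShape q₀) (S.locDom q₀) := by
  refine contDiffOn_clm_apply.2 fun a ↦ ?_
  have cν : ContDiffOn ℝ ∞ (S.locField q₀ S.normal) (S.locDom q₀) :=
    contDiffOn_locField S.contMDiff_normal
  have cν' : ContDiffOn ℝ ∞ (fderiv ℝ (S.locField q₀ S.normal)) (S.locDom q₀) :=
    cν.fderiv_of_isOpen (S.isOpen_locDom q₀) (by simp)
  have cΓ : ContDiffOn ℝ ∞ (fun x ↦ Γ (S.locMap q₀ x)) (S.locDom q₀) :=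
    hΓ.contDiffOn.comp contDiffOn_locMap fun _ hx ↦ locMap_mem hx
  have c1 : ContDiffOn ℝ ∞ (fun x ↦ covDeriv Γ (S.locMap q₀) (S.locField q₀ S.normal) x a)
      (S.locDom q₀) :=
    (cν'.clm_apply contDiffOn_const).add
      ((cΓ.clm_apply (contDiffOn_fderiv_locMap.clm_apply contDiffOn_const)).clm_apply cν)
  refine contDiffOn_of_represents contDiffOn_locMetric
    ((contDiffOn_chartMetric_locMap.clm_apply c1.neg).clm_comp
      contDiffOn_fderiv_locMap) (fun x hx v hv ↦ locMetric_pos hx hv) fun x hx w ↦ ?_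
  rw [locMetric_apply, covDeriv_locNormal hΓ hx, neg_neg]
  rfl

theorem metric_shape_symm (q : L) (v w : TangentSpace (𝓡 n) q) :
    S.metric q (S.shape q v) w = S.metric q v (S.shape q w) := by
  obtain ⟨Γ, hΓ⟩ := exists_isChristoffel_chart (F := 𝔽) (S.toFun q)
  have hx := S.chart_mem_locDom q
  have h : ∀ v w : TangentSpace (𝓡 n) ((χ q).symm (χ q q)),
      S.metric _ (S.shape _ v) w = S.metric _ v (S.shape _ w) := fun v w ↦ by
    rw [metric_eq_locMetric hx, metric_eq_locMetric hx, coord_shape hx, coord_shape hx,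
      locMetric_locShape_symm hΓ hx]
  rw [(χ q).left_inv (mem_extChartAt_source q)] at h
  exact h v w

theorem meanCurv_eq_traceSymm (k : ℕ) (q : L) :
    S.meanCurv k q = traceSymm (LinearMap.trace ℝ (TangentSpace (𝓡 n) q)) (S.shape q) k :=
  esymm_roots_charpoly_eq_traceSymm (S.metric q) (S.metric_symm q) (fun _ hv ↦ S.metric_pos q hv)
    (S.shape q) (metric_shape_symm q) k

theorem newton_eq_traceNewton (k : ℕ) (q : L) :
    S.newton q k = traceNewton (LinearMap.trace ℝ (TangentSpace (𝓡 n) q)) (S.shape q) k := by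
  induction k with
  | zero => rfl
  | succ k ih => rw [newton, ih, meanCurv_eq_traceSymm, traceNewton_succ]

theorem meanCurv_eq_locShape (k : ℕ) (hx : x ∈ S.locDom q₀) :
    S.meanCurv k ((χ q₀).symm x)
      = traceSymm (traceCLM n : (𝔼 →L[ℝ] 𝔼) →ₗ[ℝ] ℝ) (S.locShape q₀ x) k := by
  rw [meanCurv_eq_traceSymm, ← chartConj_locShape hx]
  exact traceSymm_map _ _ _ _ (fun b ↦ trace_chartConj _ b) k

theorem chart_preimage_locDom_mem_nhds (q₀ : L) : χ q₀ ⁻¹' S.locDom q₀ ∈ nhds q₀ :=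
  (continuousAt_extChartAt q₀).preimage_mem_nhds (locDom_mem_nhds (S.chart_mem_locDom q₀))

theorem contMDiff_meanCurv (k : ℕ) : ContMDiff (𝓡 n) 𝓘(ℝ, ℝ) ∞ (S.meanCurv k) := by
  intro q₀
  obtain ⟨Γ, hΓ⟩ := exists_isChristoffel_chart (F := 𝔽) (S.toFun q₀)
  have hx := S.chart_mem_locDom q₀
  have hA := (contDiffOn_locShape hΓ).contDiffAt (locDom_mem_nhds hx)
  have h1 : ContDiffAt ℝ ∞
      (fun x ↦ traceSymm (traceCLM n : (𝔼 →L[ℝ] 𝔼) →ₗ[ℝ] ℝ) (S.locShape q₀ x) k) (χ q₀ q₀) :=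
    (contDiff_traceSymm (traceCLM n) k).contDiffAt.comp _ hA
  refine (ContMDiffAt.comp q₀ h1.contMDiffAt (contMDiffAt_chart
    (mem_extChartAt_source (I := 𝓡 n) q₀))).congr_of_eventuallyEq ?_
  filter_upwards [chart_preimage_locDom_mem_nhds (S := S) q₀,
    chart_source_mem_nhds (mem_extChartAt_source (I := 𝓡 n) q₀)] with q hq hq'
  have h2 := meanCurv_eq_locShape k hq
  rwa [(χ q₀).left_inv hq'] at h2

/-- The first variation of the mean curvatures, `dS_{k+1}(v) = Tr (T_k ∘ d_v A)`. -/
theorem mvfderiv_meanCurv_succ (hΓ : IsChristoffel (κ (S.toFun q₀)).target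
      (chartMetric (S.toFun q₀)) Γ) (k : ℕ) (v : TangentSpace (𝓡 n) q₀) :
    mvfderiv (𝓡 n) (S.meanCurv (k + 1)) q₀ v
      = traceCLM n (traceNewton (traceCLM n : (𝔼 →L[ℝ] 𝔼) →ₗ[ℝ] ℝ)
          (S.locShape q₀ (χ q₀ q₀)) k * fderiv ℝ (S.locShape q₀) (χ q₀ q₀) (coord 𝔼 q₀ q₀ v)) := by
  have hx := S.chart_mem_locDom q₀
  have hA := ((contDiffOn_locShape hΓ).contDiffAt (locDom_mem_nhds hx)).differentiableAt (by simp)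
  rw [mvfderiv_eq_fderiv_chart (mem_extChartAt_source (I := 𝓡 n) q₀)
    ((contMDiff_meanCurv (k + 1) q₀).mdifferentiableAt (by simp))]
  have h1 : (fun z ↦ S.meanCurv (k + 1) ((χ q₀).symm z)) =ᶠ[nhds (χ q₀ q₀)]
      fun z ↦ traceSymm (traceCLM n : (𝔼 →L[ℝ] 𝔼) →ₗ[ℝ] ℝ) (S.locShape q₀ z) (k + 1) := by
    filter_upwards [locDom_mem_nhds hx] with z hz using meanCurv_eq_locShape (k + 1) hz
  have hs := (contDiff_traceSymm (traceCLM n) (k + 1)).differentiable (by simp)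
    (S.locShape q₀ (χ q₀ q₀))
  rw [h1.fderiv_eq, fderiv_fun_comp (χ q₀ q₀) hs hA, ContinuousLinearMap.comp_apply,
    fderiv_traceSymm_succ _ traceCLM_mul_comm]

end OrientedHypersurface

end ShapeChart

/-! ### The Hessian of the support function of a Killing field -/

section SupportFunction

set_option maxSynthPendingDepth 3

variable {n : ℕ}
  {L : Type*} [TopologicalSpace L] [ChartedSpace (EuclideanSpace ℝ (Fin n)) L]
  [IsManifold (𝓡 n) ∞ L]
  {M : Type*} [TopologicalSpace M] [ChartedSpace (EuclideanSpace ℝ (Fin (n + 1))) M]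
  [IsManifold (𝓡 (n + 1)) ∞ M]
  [RiemannianBundle (fun x : M ↦ TangentSpace (𝓡 (n + 1)) x)]
  [IsContMDiffRiemannianBundle (𝓡 (n + 1)) ∞ (EuclideanSpace ℝ (Fin (n + 1)))
    (fun x : M ↦ TangentSpace (𝓡 (n + 1)) x)]

local notation "𝔼" => EuclideanSpace ℝ (Fin n)
local notation "𝔽" => EuclideanSpace ℝ (Fin (n + 1))
local notation "χ" => extChartAt (𝓡 n)
local notation "κ" => extChartAt (𝓡 (n + 1))

namespace OrientedHypersurface

variable {S : OrientedHypersurface n L M} {q₀ : L} {x : EuclideanSpace ℝ (Fin n)}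
  {Γ : EuclideanSpace ℝ (Fin (n + 1)) →
    EuclideanSpace ℝ (Fin (n + 1)) →L[ℝ] EuclideanSpace ℝ (Fin (n + 1)) →L[ℝ]
      EuclideanSpace ℝ (Fin (n + 1))}
  {U : Π x : M, TangentSpace (𝓡 (n + 1)) x} {f : L → ℝ}

theorem contMDiffAt_of_locField {V : Π q : L, TangentSpace (𝓡 (n + 1)) (S.toFun q)}
    (hV : ContDiffAt ℝ ∞ (S.locField q₀ V) (χ q₀ q₀)) :
    ContMDiffAt (𝓡 n) (𝓡 (n + 1)).tangent ∞
      (fun q ↦ (⟨S.toFun q, V q⟩ : TangentBundle (𝓡 (n + 1)) M)) q₀ := by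
  have hq := mem_extChartAt_source (I := 𝓡 n) q₀
  refine ((trivializationAt 𝔽 (TangentSpace (𝓡 (n + 1))) (S.toFun q₀)).contMDiffAt_iff
    (x₀ := q₀) ((Trivialization.mem_source _).2
      (mem_baseSet (mem_extChartAt_source (I := 𝓡 (n + 1)) (S.toFun q₀))))).2
    ⟨S.contMDiff q₀, (ContMDiffAt.comp q₀ hV.contMDiffAt (contMDiffAt_chart hq)
      ).congr_of_eventuallyEq ?_⟩
  filter_upwards [chart_preimage_locDom_mem_nhds (S := S) q₀, chart_source_mem_nhds hq]
    with q hq hq'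
  have h1 : S.locField q₀ V (χ q₀ q) = _ := coord_eq_snd hq.2 (V ((χ q₀).symm (χ q₀ q)))
  rw [(χ q₀).left_inv hq'] at h1
  exact h1.symm

theorem contMDiff_killing_comp (hU : IsKilling U) :
    ContMDiff (𝓡 n) (𝓡 (n + 1)).tangent ∞
      (fun q ↦ (⟨S.toFun q, U (S.toFun q)⟩ : TangentBundle (𝓡 (n + 1)) M)) :=
  hU.contMDiff.comp S.contMDiff

theorem contMDiff_support (hU : IsKilling U)
    (hf : ∀ q : L, f q = inner ℝ (U (S.toFun q)) (S.normal q)) :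
    ContMDiff (𝓡 n) 𝓘(ℝ, ℝ) ∞ f := by
  rw [funext hf]
  exact fun q ↦ ContMDiffAt.inner_bundle (E := fun x : M ↦ TangentSpace (𝓡 (n + 1)) x) (F := 𝔽)
    (IB := 𝓡 (n + 1)) (b := S.toFun) (v := fun q ↦ U (S.toFun q)) (w := S.normal)
    (contMDiff_killing_comp hU q) (S.contMDiff_normal q)

theorem differentiableAt_support (hU : IsKilling U)
    (hf : ∀ q : L, f q = inner ℝ (U (S.toFun q)) (S.normal q)) (hx : x ∈ S.locDom q₀) :
    DifferentiableAt ℝ (fun z ↦ f ((χ q₀).symm z)) x := by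
  have h1 := (mdifferentiableAt_iff_chart (symm_mem_source hx)).1
    ((contMDiff_support hU hf ((χ q₀).symm x)).mdifferentiableAt (by simp))
  rwa [(χ q₀).right_inv hx.1] at h1

theorem contDiffOn_hat (hU : IsKilling U) :
    ContDiffOn ℝ ∞ (hat (S.toFun q₀) U) (κ (S.toFun q₀)).target := fun _ hy ↦
  (contDiffAt_hat hy (hU.contMDiff _)).contDiffWithinAt

theorem hat_locMap (hx : x ∈ S.locDom q₀) :
    hat (S.toFun q₀) U (S.locMap q₀ x) = S.locField q₀ (fun q ↦ U (S.toFun q)) x :=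
  hat_apply_chart hx.2 U

/-- The decomposition of a field into its tangential and normal parts, in a chart. -/
theorem hat_eq_tang_add_normal (hf : ∀ q : L, f q = inner ℝ (U (S.toFun q)) (S.normal q))
    (hx : x ∈ S.locDom q₀) :
    hat (S.toFun q₀) U (S.locMap q₀ x)
      = fderiv ℝ (S.locMap q₀) x (S.locTang q₀ (fun q ↦ U (S.toFun q)) x)
        + f ((χ q₀).symm x) • S.locField q₀ S.normal x := by
  rw [hat_locMap hx, locTang, fderiv_locMap hx, locField, locField, ← map_smul, ← map_add, hf,
    S.diff_tang_add]

/-- The gradient of the support function `f = ⟨U, N⟩` is `-∇_N U - A U^⊤`. -/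
theorem locField_grad_support (hΓ : IsChristoffel (κ (S.toFun q₀)).target
      (chartMetric (S.toFun q₀)) Γ) (hU : IsKilling U)
    (hf : ∀ q : L, f q = inner ℝ (U (S.toFun q)) (S.normal q)) (hx : x ∈ S.locDom q₀) :
    S.locField q₀ (fun q ↦ S.diff q (S.grad f q)) x
      = -covDifferential Γ (hat (S.toFun q₀) U) (S.locMap q₀ x) (S.locField q₀ S.normal x)
        - fderiv ℝ (S.locMap q₀) x
          (S.locShape q₀ x (S.locTang q₀ (fun q ↦ U (S.toFun q)) x)) := by
  have hq := symm_mem_source hx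
  have hp := image_mem_source hx
  have dψ := (contDiffAt_locMap hx).differentiableAt (by simp)
  have dν := differentiableAt_locNormal hx
  have du : DifferentiableAt ℝ (hat (S.toFun q₀) U) (S.locMap q₀ x) :=
    (contDiffAt_hat (locMap_mem hx) (hU.contMDiff _)).differentiableAt (by simp)
  have duψ : DifferentiableAt ℝ (fun z ↦ hat (S.toFun q₀) U (S.locMap q₀ z)) x :=
    DifferentiableAt.comp (g := hat (S.toFun q₀) U) x du dψ
  have hskew := hU.covDifferential_skew hΓ (locMap_mem hx)
  set X := -covDifferential Γ (hat (S.toFun q₀) U) (S.locMap q₀ x) (S.locField q₀ S.normal x)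
        - fderiv ℝ (S.locMap q₀) x
          (S.locShape q₀ x (S.locTang q₀ (fun q ↦ U (S.toFun q)) x)) with hX
  -- `X` is tangential because the covariant differential of `U` is skew
  have hXν : chartMetric (S.toFun q₀) (S.locMap q₀ x) X (S.locField q₀ S.normal x) = 0 := by
    have h1 := hskew (S.locField q₀ S.normal x) (S.locField q₀ S.normal x)
    rw [chartMetric_symm _ _ (S.locField q₀ S.normal x)] at h1
    rw [hX, map_sub, map_neg, sub_apply, neg_apply, chartMetric_fderiv_locNormal hx]
    linarith
  have hXψ (a : 𝔼) : chartMetric (S.toFun q₀) (S.locMap q₀ x) X (fderiv ℝ (S.locMap q₀) x a)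
      = fderiv ℝ (fun z ↦ f ((χ q₀).symm z)) x a := by
    have h1 : (fun z ↦ f ((χ q₀).symm z)) =ᶠ[nhds x] fun z ↦ chartMetric (S.toFun q₀)
        (S.locMap q₀ z) (hat (S.toFun q₀) U (S.locMap q₀ z)) (S.locField q₀ S.normal z) := by
      filter_upwards [locDom_mem_nhds hx] with z hz
      rw [hat_locMap hz, locField, locField, ← inner_eq_locMap hz, hf]
    rw [h1.fderiv_eq, hΓ.fderiv_metric (locMap_mem hx) dψ duψ dν, covDeriv_comp du dψ,
      covDeriv_locNormal hΓ hx, hat_eq_tang_add_normal hf hx]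
    have h2 := hskew (S.locField q₀ S.normal x) (fderiv ℝ (S.locMap q₀) x a)
    have h3 := locMetric_locShape_symm hΓ hx (S.locTang q₀ (fun q ↦ U (S.toFun q)) x) a
    rw [locMetric_apply, locMetric_apply] at h3
    have h4 := chartMetric_fderiv_locNormal hx (S.locShape q₀ x a)
    rw [chartMetric_symm] at h4 h2
    rw [hX, map_sub, map_neg, sub_apply, neg_apply, h3, map_neg, map_add, map_smul, add_apply,
      smul_apply, h4, smul_zero, add_zero]
    rw [chartMetric_symm _ _ (S.locField q₀ S.normal x)] at h2
    rw [chartMetric_symm _ _ (covDifferential _ _ _ (S.locField q₀ S.normal x))]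
    linarith
  let Y : TangentSpace (𝓡 (n + 1)) (S.toFun ((χ q₀).symm x)) := ofCoord (S.toFun q₀) _ X
  have hY : coord 𝔽 (S.toFun q₀) _ Y = X := coord_ofCoord hp X
  have hYN : (inner ℝ Y (S.normal ((χ q₀).symm x)) : ℝ) = 0 := by
    rw [inner_eq_locMap hx, hY]
    exact hXν
  have hgrad : S.tang _ Y = S.grad f ((χ q₀).symm x) := S.eq_of_metric_eq _ fun v ↦ by
    rw [metric_tang, metric_grad, inner_eq_locMap hx, hY, ← fderiv_locMap hx, hXψ,
      mvfderiv_eq_fderiv_chart hq ((contMDiff_support hU hf _).mdifferentiableAt (by simp)),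
      (χ q₀).right_inv hx.1]
  have hsum := S.diff_tang_add _ Y
  rw [hYN, zero_smul, add_zero, hgrad] at hsum
  rw [locField, hsum, hY]

/-- The formula defining `normalCurv` on a basis holds for every vector, since the curvature is
linear. -/
theorem normalCurv_apply (q : L) (v : TangentSpace (𝓡 n) q) :
    S.normalCurv q v
      = S.tang q (curvatureAt (S.toFun q) (S.diff q v) (S.normal q) (S.normal q)) := by
  obtain ⟨Γ, hΓ⟩ := exists_isChristoffel_chart (F := 𝔽) (S.toFun q)
  have hp := mem_extChartAt_source (I := 𝓡 (n + 1)) (S.toFun q)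
  have hlin : IsLinearMap ℝ fun w : TangentSpace (𝓡 (n + 1)) (S.toFun q) ↦
      curvatureAt (S.toFun q) w (S.normal q) (S.normal q) := by
    constructor
    · intro v w
      rw [← ofCoord_coord hp (curvatureAt _ (v + w) _ _),
        ← ofCoord_coord hp (curvatureAt _ v _ _), ← ofCoord_coord hp (curvatureAt _ w _ _),
        coord_curvatureAt hΓ, coord_curvatureAt hΓ, coord_curvatureAt hΓ, ← map_add]
      congr 1
      simp only [localCurv, map_add, add_apply]
      abel
    · intro c w
      rw [← ofCoord_coord hp (curvatureAt _ (c • w) _ _),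
        ← ofCoord_coord hp (curvatureAt _ w _ _),
        coord_curvatureAt hΓ, coord_curvatureAt hΓ, ← map_smul]
      congr 1
      simp only [localCurv, map_smul, smul_apply]
      module
  have h : S.normalCurv q = S.tang q ∘ₗ hlin.mk' _ ∘ₗ S.diff q :=
    (Module.finBasis ℝ (TangentSpace (𝓡 n) q)).ext fun i ↦ by
      rw [normalCurv, Module.Basis.constr_basis]
      rfl
  rw [h]
  rfl

/-- The Hessian of the support function, `[dT, A] - f A² - d_T A - f R(·, N) N`, where all but the
curvature term is written in the chart around `q₀`. -/
theorem hess_support (hΓ : IsChristoffel (κ (S.toFun q₀)).target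
      (chartMetric (S.toFun q₀)) Γ) (hU : IsKilling U)
    (hf : ∀ q : L, f q = inner ℝ (U (S.toFun q)) (S.normal q)) :
    S.hess f q₀ = chartConj (mem_extChartAt_source q₀)
        (fderiv ℝ (S.locTang q₀ (fun q ↦ U (S.toFun q))) (χ q₀ q₀) * S.locShape q₀ (χ q₀ q₀)
          - S.locShape q₀ (χ q₀ q₀) * fderiv ℝ (S.locTang q₀ (fun q ↦ U (S.toFun q))) (χ q₀ q₀)
          - f q₀ • (S.locShape q₀ (χ q₀ q₀) * S.locShape q₀ (χ q₀ q₀))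
          - fderiv ℝ (S.locShape q₀) (χ q₀ q₀)
              (coord 𝔼 q₀ q₀ (S.tang q₀ (U (S.toFun q₀)))))
      - f q₀ • S.normalCurv q₀ := by
  have hq := mem_extChartAt_source (I := 𝓡 n) q₀
  have hp := mem_extChartAt_source (I := 𝓡 (n + 1)) (S.toFun q₀)
  have hx := S.chart_mem_locDom q₀
  have hqq : (χ q₀).symm (χ q₀ q₀) = q₀ := (χ q₀).left_inv hq
  have hT := (contDiffOn_locTang (contMDiff_killing_comp hU)).contDiffAt (locDom_mem_nhds hx)
  have hA := (contDiffOn_locShape hΓ).contDiffAt (locDom_mem_nhds hx)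
  have hν : ContDiffAt ℝ ∞ (S.locField q₀ S.normal) (χ q₀ q₀) :=
    contDiffAt_locField hx (S.contMDiff_normal _)
  have hψ := contDiffAt_locMap hx
  have hu := contDiffOn_hat (S := S) (q₀ := q₀) hU
  have hG : S.locField q₀ (fun q ↦ S.diff q (S.grad f q)) =ᶠ[nhds (χ q₀ q₀)]
      fun z ↦ -covDifferential Γ (hat (S.toFun q₀) U) (S.locMap q₀ z) (S.locField q₀ S.normal z)
        - fderiv ℝ (S.locMap q₀) z
          (S.locShape q₀ z (S.locTang q₀ (fun q ↦ U (S.toFun q)) z)) := by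
    filter_upwards [locDom_mem_nhds hx] with z hz using locField_grad_support hΓ hU hf hz
  have hGs : ContDiffAt ℝ ∞ (S.locField q₀ fun q ↦ S.diff q (S.grad f q)) (χ q₀ q₀) := by
    refine ContDiffAt.congr_of_eventuallyEq ?_ hG
    have hua := hu.contDiffAt (hΓ.isOpen.mem_nhds (locMap_mem hx))
    have hK : ContDiffAt ℝ ∞ (covDifferential Γ (hat (S.toFun q₀) U)) (S.locMap q₀ (χ q₀ q₀)) :=
      (hua.fderiv_right (m := ∞) (by simp)).add
        (((ContinuousLinearMap.flipₗᵢ ℝ 𝔽 𝔽 𝔽).toContinuousLinearEquiv.toContinuousLinearMap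
          |>.contDiff.contDiffAt.comp _ (hΓ.contDiffAt (locMap_mem hx))).clm_apply hua)
    exact ((hK.comp _ hψ).clm_apply hν).neg.sub
      ((hψ.fderiv_right (m := ∞) (by simp)).clm_apply (hA.clm_apply hT))
  have hcov := fun v ↦ coord_covAlong hΓ hx (V := fun q ↦ S.diff q (S.grad f q))
    (by rw [hqq]; exact (contMDiffAt_of_locField hGs).mdifferentiableAt (by simp)) v
  have hfd := differentiableAt_support hU hf hx
  have hdiff := fun v ↦ fderiv_locMap hx v
  have key := fun v ↦ hΓ.covDeriv_gradient_support hu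
    (fun y hy ↦ hU.covDifferential_skew hΓ hy) (locMap_mem hx) hψ hν
    (hT.differentiableAt (by simp)) (hA.differentiableAt (by simp)) hfd
    (Filter.eventually_of_mem (locDom_mem_nhds hx) fun z hz ↦ covDeriv_locNormal hΓ hz)
    (Filter.eventually_of_mem (locDom_mem_nhds hx) fun z hz ↦ hat_eq_tang_add_normal hf hz) v
  have hψ₀ : S.locMap q₀ (χ q₀ q₀) = κ (S.toFun q₀) (S.toFun q₀) := by rw [locMap, hqq]
  have hν₀ : S.locField q₀ S.normal (χ q₀ q₀) = coord 𝔽 (S.toFun q₀) _ (S.normal q₀) := by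
    rw [locField, hqq]
  have hT₀ : S.locTang q₀ (fun q ↦ U (S.toFun q)) (χ q₀ q₀)
      = coord 𝔼 q₀ q₀ (S.tang q₀ (U (S.toFun q₀))) := by rw [locTang, hqq]
  rw [hqq] at hcov hdiff
  simp only [hqq, hψ₀, hν₀, hT₀] at key
  ext1 v
  set B := fderiv ℝ (S.locTang q₀ (fun q ↦ U (S.toFun q))) (χ q₀ q₀) * S.locShape q₀ (χ q₀ q₀)
    - S.locShape q₀ (χ q₀ q₀) * fderiv ℝ (S.locTang q₀ (fun q ↦ U (S.toFun q))) (χ q₀ q₀)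
          - f q₀ • (S.locShape q₀ (χ q₀ q₀) * S.locShape q₀ (χ q₀ q₀))
          - fderiv ℝ (S.locShape q₀) (χ q₀ q₀)
              (coord 𝔼 q₀ q₀ (S.tang q₀ (U (S.toFun q₀))))
  obtain ⟨c, hc⟩ : ∃ c : ℝ, coord 𝔽 (S.toFun q₀) _
      (S.covAlong (fun q ↦ S.diff q (S.grad f q)) q₀ v)
      = fderiv ℝ (S.locMap q₀) (χ q₀ q₀) (B (coord 𝔼 q₀ q₀ v))
        + c • coord 𝔽 (S.toFun q₀) _ (S.normal q₀)
        - f q₀ • coord 𝔽 (S.toFun q₀) _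
          (curvatureAt (S.toFun q₀) (S.diff q₀ v) (S.normal q₀) (S.normal q₀)) := by
    refine ⟨fderiv ℝ (fun z ↦ f ((χ q₀).symm z)) (χ q₀ q₀)
      (S.locShape q₀ (χ q₀ q₀) (coord 𝔼 q₀ q₀ v)), ?_⟩
    rw [hcov, covDeriv_congr hG, coord_curvatureAt hΓ, ← hdiff]
    exact key _
  rw [← coord_ofCoord hq (B (coord 𝔼 q₀ q₀ v)), hdiff, ← map_smul, ← map_smul, ← map_add,
    ← map_sub] at hc
  have hc' := congrArg (ofCoord (S.toFun q₀) (S.toFun q₀)) hc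
  rw [ofCoord_coord hp, ofCoord_coord hp] at hc'
  change S.tang q₀ (S.covAlong (fun q ↦ S.diff q (S.grad f q)) q₀ v) = _
  rw [hc', map_sub, map_add, tang_diff, map_smul, map_smul, tang_normal, smul_zero, add_zero,
    LinearMap.sub_apply, LinearMap.smul_apply, normalCurv_apply, chartConj_apply]

/-- The trace of the Hessian against the Newton transformation. The commutator `[dT, A]` drops out
because the Newton transformation commutes with `A`. -/
theorem opJ_support (hU : IsKilling U)
    (hf : ∀ q : L, f q = inner ℝ (U (S.toFun q)) (S.normal q)) (r : ℕ) (q₀ : L) :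
    S.opJ r f q₀ = -mvfderiv (𝓡 n) (S.meanCurv (r + 1)) q₀ (S.tang q₀ (U (S.toFun q₀))) := by
  obtain ⟨Γ, hΓ⟩ := exists_isChristoffel_chart (F := 𝔽) (S.toFun q₀)
  have hq := mem_extChartAt_source (I := 𝓡 n) q₀
  have hA : S.shape q₀ = chartConj hq (S.locShape q₀ (χ q₀ q₀)) := by
    ext1 v
    rw [chartConj_apply, locShape_apply, (χ q₀).left_inv hq, ofCoord_coord hq, ofCoord_coord hq]
  set A := S.locShape q₀ (χ q₀ q₀)
  set P := traceNewton (traceCLM n : (𝔼 →L[ℝ] 𝔼) →ₗ[ℝ] ℝ) A r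
  set D := fderiv ℝ (S.locTang q₀ (fun q ↦ U (S.toFun q))) (χ q₀ q₀)
  have hP : S.newton q₀ r = chartConj hq P := by
    rw [newton_eq_traceNewton, hA]
    exact traceNewton_map _ _ _ _ (fun b ↦ trace_chartConj _ b) r
  have hcomm : A * P = P * A := commute_traceNewton _ _ _
  have h1 : traceCLM n (P * (D * A)) = traceCLM n (P * (A * D)) := by
    rw [← mul_assoc, traceCLM_mul_comm, ← mul_assoc, hcomm, mul_assoc]
  have h2 : traceCLM n (P * (A * A)) = traceCLM n (A ^ 2 * P) := by
    rw [traceCLM_mul_comm, sq]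
  have h3 : LinearMap.trace ℝ (TangentSpace (𝓡 n) q₀) (chartConj hq P * S.normalCurv q₀)
      = LinearMap.trace ℝ (TangentSpace (𝓡 n) q₀) (S.normalCurv q₀ * chartConj hq P) :=
    LinearMap.trace_mul_comm ..
  rw [opJ, opL, hess_support hΓ hU hf, mvfderiv_meanCurv_succ hΓ, hP, hA, mul_sub, map_sub,
    mul_smul_comm, map_smul, h3, ← map_mul, ← map_pow, ← map_mul, trace_chartConj, trace_chartConj,
    mul_sub, mul_sub, mul_sub, map_sub, map_sub, map_sub, mul_smul_comm, map_smul, h1, h2]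
  simp only [smul_eq_mul]
  ring

end OrientedHypersurface

end SupportFunction

end HypersurfaceGeometry

theorem corollaryc {n : ℕ}
    {M : Type*} [TopologicalSpace M] [ChartedSpace (EuclideanSpace ℝ (Fin (n + 1))) M]
    [IsManifold (𝓡 (n + 1)) ∞ M]
    [RiemannianBundle (fun x : M ↦ TangentSpace (𝓡 (n + 1)) x)]
    [IsContMDiffRiemannianBundle (𝓡 (n + 1)) ∞ (EuclideanSpace ℝ (Fin (n + 1)))
      (fun x : M ↦ TangentSpace (𝓡 (n + 1)) x)]
    {L : Type*} [TopologicalSpace L] [ChartedSpace (EuclideanSpace ℝ (Fin n)) L]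
    [IsManifold (𝓡 n) ∞ L]
    (S : HypersurfaceGeometry.OrientedHypersurface n L M)
    (U : Π x : M, TangentSpace (𝓡 (n + 1)) x) (hU : HypersurfaceGeometry.IsKilling U)
    (f : L → ℝ) (hf : ∀ q : L, f q = inner ℝ (U (S.toFun q)) (S.normal q)) (r : ℕ) :
    ContMDiff (𝓡 n) 𝓘(ℝ, ℝ) ∞ f ∧
    ContMDiff (𝓡 n) 𝓘(ℝ, ℝ) ∞ (S.meanCurv (r + 1)) ∧
    ∀ q : L,
      S.opJ r f q = -(mvfderiv (𝓡 n) (S.meanCurv (r + 1)) q (S.tang q (U (S.toFun q)))) ∧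
      S.opJ r f q
        = -inner ℝ (S.diff q (S.grad (S.meanCurv (r + 1)) q)) (U (S.toFun q)) := by
  refine ⟨HypersurfaceGeometry.OrientedHypersurface.contMDiff_support hU hf,
    HypersurfaceGeometry.OrientedHypersurface.contMDiff_meanCurv (r + 1), fun q ↦ ?_⟩
  have h := HypersurfaceGeometry.OrientedHypersurface.opJ_support hU hf r q
  refine ⟨h, ?_⟩
  rw [h, ← S.metric_grad, real_inner_comm, ← S.metric_tang, S.metric_symm]
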